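/- Let $m$ be a positive integer, let $p\in(1,\infty)$, and let $L^p(\mathbb R^m)$ denote the space of scalar-valued (real or complex) $L^p$ functions. A dyadic grid $\mathcal D$ in $\mathbb R^m$ is a collection $\bigcup_{i\in\mathbb Z}\mathcal D_i$, where each $\mathcal D_i$ is a translate of the partition $\{2^{-i}(k+[0,1)^m):k\in\mathbb Z^m\}$ of $\mathbb R^m$, and $\mathcal D_{i+1}$ refines $\mathcal D_i$. Write $\langle f\rangle_Q=\frac1{|Q|}\int_Q f$. For $Q\in\mathcal D_i$ let $\mathrm{ch}(Q)$ be the set of the $2^m$ cubes of $\mathcal D_{i+1}$ contained in $Q$. For locally integrable $b$ put $$\Delta_Q b=\sum_{Q'\in \mathrm{ch}(Q)}\big(\langle b\rangle_{Q'}-\langle b\rangle_Q\big)1_{Q'},\qquad \|b\|_{\mathrm{BMO}_{\mathcal D}}=\sup_{Q\in\mathcal D}\frac1{|Q|}\int_Q|b-\langle b\rangle_Q|.$$ **Proposition 5.1.** There is a constant $C$ depending only on $m$ and $p$ such that the following holds. Let $\mathcal D$ be a dyadic grid in $\mathbb R^m$ and let $(b_i)_{i\in\mathcal I}$ be any family of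 scalar-valued locally integrable functions on $\mathbb R^m$ with $\|b_i\|_{\mathrm{BMO}_{\mathcal D}}\le 1$ for all $i\in\mathcal I$. Then for every $i\in\mathcal I$ and $f\in L^p(\mathbb R^m)$ the series $$\pi_{\mathcal D,b_i}f=\sum_{Q\in\mathcal D}\langle f\rangle_Q\,\Delta_Q b_i$$ converges unconditionally in $L^p(\mathbb R^m)$ and defines a bounded linear operator $\pi_{\mathcal D,b_i}$ on $L^p(\mathbb R^m)$. Moreover, the family $\{\pi_{\mathcal D,b_i}:i\in\mathcal I\}$ is $\mathcal R$-bounded with constant at most $C$: for all $N$, all $T_1,\dots,T_N$ in this family and all $f_1,\dots,f_N\in L^p(\mathbb R^m)$, $$\Big(\mathbb E\Big\|\sum_{n=1}^N\varepsilon_nT_nf_n\Big\|_{L^p(\mathbb R^m)}^2\Big)^{1/2}\le C\Big(\mathbb E\Big\|\sum_{n=1}^N\varepsilon_nf_n\Big\|_{L^p(\mathbb R^m)}^2\Big)^{1/2},$$ where $\varepsilon_1,\dots,\varepsilon_N$ are independent random signs, each equal to $\pm1$ with probability $1/2$. -/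

import Mathlib

open MeasureTheory
open scoped ENNReal NNReal BigOperators

noncomputable section

/-- A dyadic grid in `ℝ^m` (points are `Fin m → ℝ`; only the Lebesgue measure is used, the norm
plays no role). For each `i : ℤ`, the cubes of generation `i` are the half-open cubes
`origin i + 2^(-i) (k + [0,1)^m)`, `k ∈ ℤ^m`, of side length `2^(-i)`. The field `nested` says that
generation `i + 1` refines generation `i`. The integer vector `step i` is determined by `origin`.
The standard grid has `origin = 0` and `step = 0`, and randomly shifted grids have
`origin i = ∑_{j > i} 2^(-j) w_j` and `step i = w_(i+1)`, where `w_j ∈ {0,1}^m`. -/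
structure DyadicGrid (m : ℕ) where
  origin : ℤ → Fin m → ℝ
  step : ℤ → Fin m → ℤ
  nested : ∀ i j, origin i j = origin (i + 1) j + (2 : ℝ) ^ (-(i + 1)) * (step i j : ℝ)

/-- Index of a dyadic cube: its generation `i` and its position `k`. -/
abbrev CubeIndex (m : ℕ) : Type := ℤ × (Fin m → ℤ)

namespace DyadicGrid

variable {m : ℕ} {𝕜 : Type*} [RCLike 𝕜]

/-- The dyadic cube `origin i + 2^(-i) (k + [0,1)^m)` with index `Q = (i, k)`. -/
def cube (D : DyadicGrid m) (Q : CubeIndex m) : Set (Fin m → ℝ) :=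
  Set.univ.pi fun j =>
    Set.Ico (D.origin Q.1 j + (2 : ℝ) ^ (-Q.1) * (Q.2 j : ℝ))
      (D.origin Q.1 j + (2 : ℝ) ^ (-Q.1) * ((Q.2 j : ℝ) + 1))

/-- The `2^m` dyadic children of the cube with index `Q`, parametrised by `η ∈ {0,1}^m`: in the
`j`-th coordinate, `η j = 0` selects the left half and `η j = 1` the right half. -/
def child (D : DyadicGrid m) (Q : CubeIndex m) (η : Fin m → Fin 2) : CubeIndex m :=
  (Q.1 + 1, fun j => 2 * Q.2 j + D.step Q.1 j + ((η j : ℕ) : ℤ))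

/-- The average `⟨f⟩_Q` of `f` over the cube `Q`. -/
def avg (D : DyadicGrid m) (f : (Fin m → ℝ) → 𝕜) (Q : CubeIndex m) : 𝕜 :=
  ⨍ x in D.cube Q, f x ∂volume

/-- The dyadic BMO norm `sup_Q |Q|⁻¹ ∫_Q |b - ⟨b⟩_Q|`, as an extended non-negative number. -/
def bmoNorm (D : DyadicGrid m) (b : (Fin m → ℝ) → 𝕜) : ℝ≥0∞ :=
  ⨆ Q : CubeIndex m, ⨍⁻ x in D.cube Q, ‖b x - D.avg b Q‖ₑ ∂volume

/-- The martingale difference `Δ_Q b = ∑_{Q' ∈ ch(Q)} (⟨b⟩_{Q'} - ⟨b⟩_Q) 1_{Q'}`. -/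
def martingaleDiff (D : DyadicGrid m) (b : (Fin m → ℝ) → 𝕜) (Q : CubeIndex m) :
    (Fin m → ℝ) → 𝕜 :=
  fun x => ∑ η : Fin m → Fin 2,
    (D.cube (D.child Q η)).indicator (fun _ => D.avg b (D.child Q η) - D.avg b Q) x

theorem measurableSet_cube (D : DyadicGrid m) (Q : CubeIndex m) : MeasurableSet (D.cube Q) :=
  MeasurableSet.univ_pi fun _ => measurableSet_Ico

theorem volume_cube_ne_top (D : DyadicGrid m) (Q : CubeIndex m) : volume (D.cube Q) ≠ ∞ := by
  rw [cube, volume_pi_pi]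
  exact ENNReal.prod_ne_top fun j _ => by simp [Real.volume_Ico]

theorem memLp_martingaleDiff (D : DyadicGrid m) (b : (Fin m → ℝ) → 𝕜) (Q : CubeIndex m)
    (p : ℝ≥0∞) : MemLp (D.martingaleDiff b Q) p volume :=
  memLp_finsetSum _ fun η _ =>
    memLp_indicator_const p (D.measurableSet_cube (D.child Q η)) _
      (Or.inr (D.volume_cube_ne_top (D.child Q η)))

/-- `T` is the dyadic paraproduct `π_{D,b}` as a bounded operator on `L^p(ℝ^m)`: for every
`f ∈ L^p(ℝ^m)` the series `∑_Q ⟨f⟩_Q Δ_Q b` over all cubes of the grid converges unconditionally in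
`L^p(ℝ^m)`, and `T f` is its sum. In particular `T` is determined by `D` and `b`. -/
def IsParaproduct (D : DyadicGrid m) (b : (Fin m → ℝ) → 𝕜) {p : ℝ≥0∞} [Fact (1 ≤ p)]
    (T : Lp 𝕜 p (volume : Measure (Fin m → ℝ)) →L[𝕜] Lp 𝕜 p (volume : Measure (Fin m → ℝ))) :
    Prop :=
  ∀ f : Lp 𝕜 p (volume : Measure (Fin m → ℝ)),
    HasSum (fun Q : CubeIndex m =>
      D.avg (fun x => f x) Q • (D.memLp_martingaleDiff b Q p).toLp (D.martingaleDiff b Q)) (T f)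

end DyadicGrid

/-- The random norm `(𝔼 ‖∑_n ε_n x_n‖²)^(1/2)`, where `ε_1, …, ε_N` are independent uniformly
distributed random signs; the expectation is the average over the `2^N` choices of signs. -/
def rademacherNorm {X : Type*} [NormedAddCommGroup X] {N : ℕ} (x : Fin N → X) : ℝ :=
  Real.sqrt ((∑ ε : Fin N → ℤˣ, ‖∑ n, (ε n : ℤ) • x n‖ ^ 2) / 2 ^ N)

/-- The family `𝒯` of bounded operators is R-bounded and `R(𝒯) ≤ C`. -/
def HasRBound {𝕜 X Y : Type*} [RCLike 𝕜] [NormedAddCommGroup X] [NormedSpace 𝕜 X]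
    [NormedAddCommGroup Y] [NormedSpace 𝕜 Y] (𝒯 : Set (X →L[𝕜] Y)) (C : ℝ≥0) : Prop :=
  ∀ (N : ℕ) (T : Fin N → X →L[𝕜] Y) (x : Fin N → X), (∀ n, T n ∈ 𝒯) →
    rademacherNorm (fun n => T n (x n)) ≤ C * rademacherNorm x

end

/-! By Khintchine's inequality the random norm in `L^p` is equivalent to the `L^p` norm of the
square function, so R-boundedness amounts to bounding the `L^p` norm of `(∑ |π_{b_n} f_n|²)^(1/2)`
by that of `(∑ |f_n|²)^(1/2)`, uniformly over finite partial sums of the paraproducts.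

Pairing with `(g_n)` in the dual exponent leaves the positive form `∑_Q |Q| ∑_n |⟨f_n⟩_Q| · avg(|Δ_Q
b_n| |Δ_Q g_n|)`. The John–Nirenberg inequality (`treeSum_treeVar_le`) makes `|Δ_Q b_n|²` a Carleson
sequence, with a constant independent of `n`. Let `φ` and `γ` be the averages of the `ℓ²` norms of
`(f_n)` and `(g_n)`. While they stay below fixed multiples of thresholds `F` and `G`, the quadratic
Carleson embedding for each `f_n` and orthogonality for each `g_n`, summed over `n`, bound the form
by a multiple of `F G` per unit mass. When `φ` or `γ` passes its threshold, the threshold is raised.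
The products `F G` so produced are summed by Young's inequality and Doob's maximal inequality. The
Bellman function `U` in `exists_treeSum_paraForm_le` performs all of this in one induction on the
depth of the tree.

A normalised dual extremiser turns the bound on the form into the square function estimate. The case
of one function bounds all finite partial sums of a paraproduct. Since `L^p` has finite cotype, this
forces unconditional convergence (`summable_Lp_of_norm_sum_le`), and the R-bound passes to the
limit. -/

noncomputable section

/-! ### Martingales on trees: John–Nirenberg and the Carleson embedding step. -/

section Tree

variable {I κ : Type} [Fintype κ] {𝕜 : Type*} [RCLike 𝕜]

/-- `f` is a martingale on the tree with children `ch`: its value at a vertex is the mean of its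
values at the children. -/
def IsTreeMartingale {E : Type*} [AddCommGroup E] [Module ℝ E] (ch : I → κ → I) (f : I → E) :
    Prop :=
  ∀ Q, ∑ η, f (ch Q η) = (Fintype.card κ : ℝ) • f Q

/-- The sum of `a` over the first `k` generations below a vertex, each generation being weighted
by its relative measure. -/
def treeSum (ch : I → κ → I) (a : I → ℝ) : ℕ → I → ℝ
  | 0, _ => 0
  | k + 1, Q => a Q + (∑ η, treeSum ch a k (ch Q η)) / Fintype.card κ

/-- The conditional variance of `b` at `Q`. -/
def treeVar (ch : I → κ → I) (b : I → 𝕜) (Q : I) : ℝ :=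
  (∑ η, ‖b (ch Q η) - b Q‖ ^ 2) / Fintype.card κ

/-- Pythagoras: the deviations from the mean sum to zero, so the cross terms cancel. -/
theorem sum_norm_sq_eq_of_sum_eq {d : κ → 𝕜} {a : 𝕜}
    (h : ∑ η, d η = (Fintype.card κ : ℝ) • a) :
    ∑ η, ‖d η‖ ^ 2 = Fintype.card κ * ‖a‖ ^ 2 + ∑ η, ‖d η - a‖ ^ 2 := by
  have h1 : ∀ η, ‖d η‖ ^ 2 = ‖a‖ ^ 2 + 2 * inner ℝ a (d η - a) + ‖d η - a‖ ^ 2 := fun η => by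
    rw [← norm_add_sq_real]; simp
  have h2 : ∑ η, (d η - a) = 0 := by
    rw [Finset.sum_sub_distrib, h]
    simp [RCLike.real_smul_eq_coe_mul]
  simp_rw [h1, Finset.sum_add_distrib, ← Finset.mul_sum, ← inner_sum, h2]
  simp

variable {ch : I → κ → I}

theorem treeVar_nonneg (b : I → 𝕜) (Q : I) : 0 ≤ treeVar ch b Q := by
  unfold treeVar; positivity

theorem treeSum_nonneg {a : I → ℝ} (ha : ∀ Q, 0 ≤ a Q) (k : ℕ) (Q : I) :
    0 ≤ treeSum ch a k Q := by
  induction k generalizing Q with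
  | zero => simp [treeSum]
  | succ k ih =>
    have := Finset.sum_nonneg fun η (_ : η ∈ Finset.univ) => ih (ch Q η)
    have := ha Q
    simp only [treeSum]
    positivity

/-- Bounds the overshoot when a stopping threshold is first passed. -/
theorem le_card_mul_of_martingale {φ : I → ℝ} (h : IsTreeMartingale ch φ) (h0 : ∀ Q, 0 ≤ φ Q)
    (Q : I) (η : κ) : φ (ch Q η) ≤ Fintype.card κ * φ Q := by
  have := h Q
  rw [smul_eq_mul] at this
  rw [← this]
  exact Finset.single_le_sum (f := fun η => φ (ch Q η)) (fun _ _ => h0 _) (Finset.mem_univ η)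

/-- The John–Nirenberg inequality in its Carleson measure form. -/
theorem treeSum_treeVar_le [Nonempty κ] {b : I → 𝕜} (hb : IsTreeMartingale ch b) {β : I → I → ℝ}
    (hβ : ∀ R, IsTreeMartingale ch (β R)) (hdom : ∀ R Q, ‖b Q - b R‖ ≤ β R Q)
    (hone : ∀ R, β R R ≤ 1) (k : ℕ) (R : I) :
    treeSum ch (treeVar ch b) k R ≤ 4 * (Fintype.card κ : ℝ) ^ 2 := by
  set K : ℝ := (Fintype.card κ : ℝ) with hK
  have hK1 : 1 ≤ K := by
    rw [hK]; exact_mod_cast Fintype.card_pos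
  induction k using Nat.strong_induction_on generalizing R with
  | _ k ih =>
    have hβ0 : ∀ Q, 0 ≤ β R Q := fun Q => (norm_nonneg _).trans (hdom R Q)
    -- Stopping at the first vertex where `β R` exceeds `2`. Before stopping, `4 K² β R - ‖b - b
    -- R‖²` loses exactly the conditional variance in each generation, since `β R` and `b` are
    -- martingales.
    have key : ∀ j ≤ k, ∀ Q, β R Q ≤ 2 →
        treeSum ch (treeVar ch b) j Q ≤ 4 * K ^ 2 * β R Q - ‖b Q - b R‖ ^ 2 := by
      intro j
      induction j with
      | zero =>
        intro _ Q hQ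
        simp only [treeSum]
        have h1 : ‖b Q - b R‖ ^ 2 ≤ β R Q ^ 2 := by gcongr; exact hdom R Q
        have h2 : β R Q * 1 ≤ β R Q * K ^ 2 := by
          gcongr
          · exact hβ0 Q
          · nlinarith
        nlinarith [hβ0 Q]
      | succ j ihj =>
        intro hj Q hQ
        have hch : ∀ η, treeSum ch (treeVar ch b) j (ch Q η) ≤
            4 * K ^ 2 * β R (ch Q η) - ‖b (ch Q η) - b R‖ ^ 2 := by
          intro η
          by_cases h2 : β R (ch Q η) ≤ 2
          · exact ihj (by omega) _ h2
          -- A stopped child is handled by the outer induction with itself as the new root. This is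
          -- affordable: there `β R > 2` and `‖b - b R‖ ≤ 2 K`, so the right-hand side is at least
          -- `8 K² - 4 K²`.
          · have h3 := ih j (by omega) (ch Q η)
            have h4 := le_card_mul_of_martingale (hβ R) hβ0 Q η
            have h5 : ‖b (ch Q η) - b R‖ ≤ 2 * K := (hdom _ _).trans (by nlinarith)
            push Not at h2
            nlinarith [norm_nonneg (b (ch Q η) - b R)]
        have hsum := Finset.sum_le_sum fun η (_ : η ∈ Finset.univ) => hch η
        have hvar := sum_norm_sq_eq_of_sum_eq (d := fun η => b (ch Q η) - b R) (a := b Q - b R)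
          (by rw [Finset.sum_sub_distrib, hb Q]; simp [RCLike.real_smul_eq_coe_mul, mul_sub])
        simp only [sub_sub_sub_cancel_right] at hvar
        rw [Finset.sum_sub_distrib, ← Finset.mul_sum, hβ R Q, hvar, smul_eq_mul, ← hK] at hsum
        simp only [treeSum, treeVar]
        rw [← hK, ← add_div, div_le_iff₀ (by linarith)]
        linarith
    have := key k le_rfl R ((hone R).trans one_le_two)
    simp only [sub_self, norm_zero] at this
    nlinarith [hone R, sq_nonneg K]

/-- The quadratic Carleson embedding step: `x² / (1 + M)` decreases by the Carleson mass. -/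
theorem carleson_step [Nonempty κ] {f : κ → 𝕜} {a : 𝕜}
    (h : ∑ η, f η = (Fintype.card κ : ℝ) • a) {M : κ → ℝ} (hM : ∀ η, 0 ≤ M η) {d : ℝ}
    (hd : 0 ≤ d) (h1 : d + (∑ η, M η) / Fintype.card κ ≤ 1) :
    Fintype.card κ * (‖a‖ ^ 2 * d / 4 + ‖a‖ ^ 2 / (1 + (d + (∑ η, M η) / Fintype.card κ))) ≤
      ∑ η, ‖f η‖ ^ 2 / (1 + M η) := by
  set K : ℝ := (Fintype.card κ : ℝ) with hK
  have hK0 : 0 < K := by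
    rw [hK]; exact_mod_cast Fintype.card_pos
  -- Cauchy–Schwarz in the form expressing joint convexity of `x² / y`.
  have hcs := Finset.sq_sum_div_le_sum_sq_div Finset.univ (fun η => ‖f η‖)
    (g := fun η => 1 + M η) (fun η _ => by linarith [hM η])
  have hS : ∑ η, (1 + M η) = K * (1 + (∑ η, M η) / K) := by
    rw [Finset.sum_add_distrib]
    field_simp
    simp [hK]
  have hKa : K * ‖a‖ ≤ ∑ η, ‖f η‖ := by
    have := norm_sum_le Finset.univ f
    rwa [h, norm_smul, Real.norm_of_nonneg hK0.le] at this
  have hm : 0 ≤ (∑ η, M η) / K := div_nonneg (Finset.sum_nonneg fun η _ => hM η) hK0.le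
  set m := (∑ η, M η) / K
  refine le_trans ?_ hcs
  rw [hS]
  have h2 : (K * ‖a‖) ^ 2 / (K * (1 + m)) ≤ (∑ η, ‖f η‖) ^ 2 / (K * (1 + m)) := by
    gcongr
  refine le_trans ?_ h2
  have h3 : (K * ‖a‖) ^ 2 / (K * (1 + m)) = K * (‖a‖ ^ 2 / (1 + m)) := by field_simp
  rw [h3]
  gcongr
  have h4 : ‖a‖ ^ 2 / (1 + m) - ‖a‖ ^ 2 / (1 + (d + m)) =
      ‖a‖ ^ 2 * d / ((1 + m) * (1 + (d + m))) := by
    field_simp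
    ring
  -- Both factors of the denominator are at most `2`, because the total Carleson mass is at most
  -- `1`.
  have h5 : ‖a‖ ^ 2 * d / 4 ≤ ‖a‖ ^ 2 * d / ((1 + m) * (1 + (d + m))) := by
    gcongr
    nlinarith
  linarith

end Tree

/-! ### The potential for Doob's maximal inequality. -/

/-- The potential in Doob's maximal inequality, where `F` is the running maximum, `φ` the current
value of a nonnegative martingale and `Φ` that of the conditional expectation of its `p`-th
power. -/
def doobPotential (p q c F φ Φ : ℝ) : ℝ :=
  F ^ p - q * F ^ (p - 1) * φ + c * Φ

theorem rpow_sub_one_rpow_conj {p q : ℝ} (hpq : p.HolderConjugate q) {F : ℝ} (hF : 0 ≤ F) :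
    (F ^ (p - 1)) ^ q = F ^ p := by
  rw [← Real.rpow_mul hF]
  congr 1
  have := hpq.mul_eq_add
  linarith

theorem exists_mul_rpow_mul_le {p q : ℝ} (hpq : p.HolderConjugate q) :
    ∃ c : ℝ, 0 < c ∧ ∀ F φ : ℝ, 0 ≤ F → 0 ≤ φ →
      q * F ^ (p - 1) * φ ≤ F ^ p / 2 + c * φ ^ p := by
  have hq := hpq.symm.pos
  have hp := hpq.pos
  -- Scaling in Young's inequality that makes the coefficient of `F ^ p` equal to `s ^ q / q = 1 /
  -- 2`.
  set s : ℝ := (q / 2) ^ (1 / q) with hs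
  have hs0 : 0 < s := by positivity
  have hsq : s ^ q = q / 2 := by
    rw [hs, ← Real.rpow_mul (by positivity)]
    simp [hq.ne']
  refine ⟨(q / s) ^ p / p, by positivity, fun F φ hF hφ => ?_⟩
  have h := Real.young_inequality_of_nonneg (a := q / s * φ) (b := s * F ^ (p - 1))
    (by positivity) (by positivity) hpq
  rw [Real.mul_rpow (by positivity) hφ, Real.mul_rpow hs0.le (by positivity), hsq,
    rpow_sub_one_rpow_conj hpq hF] at h
  calc q * F ^ (p - 1) * φ = q / s * φ * (s * F ^ (p - 1)) := by field_simp
    _ ≤ _ := h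
    _ = _ := by field_simp; ring

/-- The coefficient `q` is chosen so that `F ^ p - q * F ^ (p - 1) * φ` is minimal at `F = φ`, by
Young's inequality. Hence raising the running maximum to the current value never costs anything. -/
theorem doobPotential_self_le {p q : ℝ} (hpq : p.HolderConjugate q) {F φ : ℝ} (c Φ : ℝ)
    (hF : 0 ≤ F) (hφ : 0 ≤ φ) : doobPotential p q c φ φ Φ ≤ doobPotential p q c F φ Φ := by
  have hq := hpq.symm.pos
  have hp := hpq.pos
  have h := Real.young_inequality_of_nonneg (a := φ) (b := F ^ (p - 1)) hφ (by positivity) hpq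
  rw [rpow_sub_one_rpow_conj hpq hF] at h
  have h1 : φ ^ (p - 1) * φ = φ ^ p := by
    rcases hφ.eq_or_lt with rfl | h0
    · simp [hp.ne']
    · rw [← Real.rpow_add_one h0.ne']; simp
  have h2 : q / p = q - 1 := by
    have := hpq.mul_eq_add
    field_simp
    linarith
  have h3 : q * (φ * F ^ (p - 1)) ≤ (q - 1) * φ ^ p + F ^ p := by
    calc q * (φ * F ^ (p - 1)) ≤ q * (φ ^ p / p + F ^ p / q) := by gcongr
      _ = q / p * φ ^ p + F ^ p := by field_simp
      _ = _ := by rw [h2]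
  simp only [doobPotential]
  nlinarith

theorem half_le_doobPotential {p q c : ℝ}
    (hc : ∀ F φ : ℝ, 0 ≤ F → 0 ≤ φ → q * F ^ (p - 1) * φ ≤ F ^ p / 2 + c * φ ^ p) (hc0 : 0 ≤ c)
    {F φ Φ : ℝ} (hF : 0 ≤ F) (hφ : 0 ≤ φ) (hΦ : φ ^ p ≤ Φ) :
    F ^ p / 2 ≤ doobPotential p q c F φ Φ := by
  have := hc F φ hF hφ
  have := mul_le_mul_of_nonneg_left hΦ hc0
  simp only [doobPotential]
  linarith

theorem doobPotential_le {p q c F φ Φ : ℝ} (hq : 0 ≤ q) (hF : 0 ≤ F) (hφ : 0 ≤ φ) :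
    doobPotential p q c F φ Φ ≤ F ^ p + c * Φ := by
  have : 0 ≤ q * F ^ (p - 1) * φ := by positivity
  simp only [doobPotential]
  linarith

/-! ### The Bellman function estimate for the paraproduct form. -/

section Tree

variable {I κ ι : Type} [Fintype κ] [Fintype ι] {𝕜 : Type*} [RCLike 𝕜] {ch : I → κ → I}

/-- With `F` frozen the potential is affine in `(φ, Φ)`. -/
theorem IsTreeMartingale.sum_doobPotential {φ Φ : I → ℝ} (hφ : IsTreeMartingale ch φ)
    (hΦ : IsTreeMartingale ch Φ) (p q c F : ℝ) (Q : I) :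
    ∑ η, doobPotential p q c F (φ (ch Q η)) (Φ (ch Q η)) =
      Fintype.card κ * doobPotential p q c F (φ Q) (Φ Q) := by
  simp only [doobPotential, Finset.sum_add_distrib, Finset.sum_sub_distrib, ← Finset.mul_sum,
    hφ Q, hΦ Q, Finset.sum_const, Finset.card_univ, nsmul_eq_mul, smul_eq_mul]
  ring

/-- The normalized absolute form of the paraproducts with symbols `b ν` at the cube `Q`. -/
def paraForm (ch : I → κ → I) (b f g : ι → I → 𝕜) (Q : I) : ℝ :=
  ∑ ν, ‖f ν Q‖ * ((∑ η, ‖b ν (ch Q η) - b ν Q‖ * ‖g ν (ch Q η) - g ν Q‖) / Fintype.card κ)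

/-- Weighted AM–GM. It is used with `r = G / F` and `s = F / G`, which balance the `f` part and the
`g` part, both of size `F G`. -/
theorem paraForm_le (b f g : ι → I → 𝕜) (Q : I) {r s : ℝ} (hrs : r * s = 1) (hr : 0 ≤ r) :
    paraForm ch b f g Q ≤ r / 2 * ∑ ν, ‖f ν Q‖ ^ 2 * treeVar ch (b ν) Q +
      s / 2 * ∑ ν, treeVar ch (g ν) Q := by
  rw [Finset.mul_sum, Finset.mul_sum, ← Finset.sum_add_distrib]
  refine Finset.sum_le_sum fun ν _ => ?_
  simp only [treeVar]
  rw [← mul_div_assoc, ← mul_div_assoc, ← mul_div_assoc, ← mul_div_assoc, ← add_div]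
  gcongr
  rw [Finset.mul_sum, Finset.mul_sum, Finset.mul_sum, Finset.mul_sum, ← Finset.sum_add_distrib]
  refine Finset.sum_le_sum fun η _ => ?_
  have h := mul_nonneg hr
    (sq_nonneg (‖f ν Q‖ * ‖b ν (ch Q η) - b ν Q‖ - s * ‖g ν (ch Q η) - g ν Q‖))
  have h1 : r * (‖f ν Q‖ * ‖b ν (ch Q η) - b ν Q‖ - s * ‖g ν (ch Q η) - g ν Q‖) ^ 2 =
      r * (‖f ν Q‖ ^ 2 * ‖b ν (ch Q η) - b ν Q‖ ^ 2) + (r * s) * s * ‖g ν (ch Q η) - g ν Q‖ ^ 2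
      - 2 * (r * s) * (‖f ν Q‖ * (‖b ν (ch Q η) - b ν Q‖ * ‖g ν (ch Q η) - g ν Q‖)) := by ring
  rw [h1, hrs] at h
  linarith

/-- The sum of the normalized paraproduct forms over a tree, bounded by a Bellman function
argument that runs Doob's maximal inequality for both functions, and the quadratic Carleson
embedding between the jumps of the maxima. -/
theorem exists_treeSum_paraForm_le [Nonempty κ] {p q : ℝ} (hpq : p.HolderConjugate q)
    (C₀ : ℝ) (hC₀ : 0 < C₀) :
    ∃ C : ℝ, 0 < C ∧ ∀ {I ι : Type} [Fintype ι] {ch : I → κ → I} {b f g : ι → I → 𝕜}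
      {φ Φ γ Γ : I → ℝ},
      (∀ ν, IsTreeMartingale ch (f ν)) → (∀ ν, IsTreeMartingale ch (g ν)) →
      IsTreeMartingale ch φ → IsTreeMartingale ch Φ →
      IsTreeMartingale ch γ → IsTreeMartingale ch Γ →
      (∀ Q, 0 ≤ φ Q) → (∀ Q, 0 ≤ γ Q) →
      (∀ Q, ∑ ν, ‖f ν Q‖ ^ 2 ≤ φ Q ^ 2) → (∀ Q, ∑ ν, ‖g ν Q‖ ^ 2 ≤ γ Q ^ 2) →
      (∀ Q, φ Q ^ p ≤ Φ Q) → (∀ Q, γ Q ^ q ≤ Γ Q) →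
      (∀ ν k Q, treeSum ch (treeVar ch (b ν)) k Q ≤ C₀) →
      ∀ k Q F G, 0 < F → 0 < G → φ Q ≤ F → γ Q ≤ G →
        treeSum ch (paraForm ch b f g) k Q ≤ C * (F ^ p + Φ Q + G ^ q + Γ Q) := by
  have hp := hpq.pos
  have hq := hpq.symm.pos
  obtain ⟨c₁, hc₁, hc₁'⟩ := exists_mul_rpow_mul_le hpq
  obtain ⟨c₂, hc₂, hc₂'⟩ := exists_mul_rpow_mul_le hpq.symm
  set K : ℝ := (Fintype.card κ : ℝ) with hK
  have hK1 : 1 ≤ K := by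
    rw [hK]; exact_mod_cast Fintype.card_pos
  have hK0 : 0 < K := by linarith
  set C₁ : ℝ := 16 * K ^ 2 * (2 * C₀ + 1 / 2) with hC₁
  have hC₁0 : 0 < C₁ := by positivity
  refine ⟨8 / 3 * C₁ * (1 + c₁ + c₂), by positivity, ?_⟩
  intro I ι _ ch b f g φ Φ γ Γ hf hg hφ hΦ hγ hΓ hφ0 hγ0 hfφ hgγ hφΦ hγΓ hcar k Q F G hF hG hFφ hGγ
  have hΦ0 : ∀ Q, 0 ≤ Φ Q := fun Q => (Real.rpow_nonneg (hφ0 Q) p).trans (hφΦ Q)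
  have hΓ0 : ∀ Q, 0 ≤ Γ Q := fun Q => (Real.rpow_nonneg (hγ0 Q) q).trans (hγΓ Q)
  let M : ι → ℕ → I → ℝ := fun ν k Q => treeSum ch (treeVar ch (b ν)) k Q / C₀
  have hM0 : ∀ ν k Q, 0 ≤ M ν k Q := fun ν k Q =>
    div_nonneg (treeSum_nonneg (treeVar_nonneg (b ν)) k Q) hC₀.le
  have hM1 : ∀ ν k Q, M ν k Q ≤ 1 := fun ν k Q => by
    simp only [M]; rw [div_le_one hC₀]; exact hcar ν k Q
  let l₁ : ℕ → I → ℝ := fun k Q => ∑ ν, ‖f ν Q‖ ^ 2 / (1 + M ν k Q)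
  let l₂ : I → ℝ := fun Q => ∑ ν, ‖g ν Q‖ ^ 2
  have hl₁0 : ∀ k Q, 0 ≤ l₁ k Q := fun k Q => Finset.sum_nonneg fun ν _ =>
    div_nonneg (sq_nonneg _) (by linarith [hM0 ν k Q])
  have hl₂0 : ∀ Q, 0 ≤ l₂ Q := fun Q => Finset.sum_nonneg fun ν _ => sq_nonneg _
  have hl₁ : ∀ k Q, l₁ k Q ≤ φ Q ^ 2 := fun k Q => (Finset.sum_le_sum fun ν _ =>
    div_le_self (sq_nonneg _) (by linarith [hM0 ν k Q])).trans (hfφ Q)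
  -- The coefficients `2 C₀` and `1 / 2` make the drops of `l₁` and `l₂` match `paraForm_le`. A jump
  -- multiplies `F G` by at least `4`, and `C₁ / 3 * 4 - C₁ / 3 = C₁` pays for the quadratic terms
  -- discarded there. By `hpot`, the factor `8 / 3` dominates `(4 / 3) C₁ F G`, which gives `0 ≤ U`
  -- at depth zero.
  let U : ℕ → I → ℝ → ℝ → ℝ := fun k Q F G =>
    8 / 3 * C₁ * (doobPotential p q c₁ F (φ Q) (Φ Q) + doobPotential q p c₂ G (γ Q) (Γ Q))
      - C₁ / 3 * (F * G) - G / F * (2 * C₀) * l₁ k Q - F / G / 2 * l₂ Q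
  -- The range `4 K` covers a child that has just overshot: its parent lies below `4 F` and `4 G`,
  -- and one generation multiplies by at most `K`.
  have hlow : ∀ k Q F G, 0 < F → 0 < G → φ Q ≤ 4 * K * F → γ Q ≤ 4 * K * G →
      G / F * (2 * C₀) * l₁ k Q + F / G / 2 * l₂ Q ≤ C₁ * (F * G) := by
    intro k Q F G hF hG h1 h2
    have h3 : l₁ k Q ≤ (4 * K * F) ^ 2 :=
      (hl₁ k Q).trans (pow_le_pow_left₀ (hφ0 Q) h1 2)
    have h4 : l₂ Q ≤ (4 * K * G) ^ 2 := (hgγ Q).trans (pow_le_pow_left₀ (hγ0 Q) h2 2)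
    calc G / F * (2 * C₀) * l₁ k Q + F / G / 2 * l₂ Q
        ≤ G / F * (2 * C₀) * (4 * K * F) ^ 2 + F / G / 2 * (4 * K * G) ^ 2 := by gcongr
      _ = C₁ * (F * G) := by rw [hC₁]; field_simp; ring
  have hpot : ∀ Q F G, 0 < F → 0 < G → F * G ≤ 2 *
      (doobPotential p q c₁ F (φ Q) (Φ Q) + doobPotential q p c₂ G (γ Q) (Γ Q)) := by
    intro Q F G hF hG
    have h1 := half_le_doobPotential hc₁' hc₁.le hF.le (hφ0 Q) (hφΦ Q)
    have h2 := half_le_doobPotential hc₂' hc₂.le hG.le (hγ0 Q) (hγΓ Q)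
    have h3 := Real.young_inequality_of_nonneg hF.le hG.le hpq
    have h4 : F ^ p / p ≤ F ^ p := div_le_self (by positivity) hpq.lt.le
    have h5 : G ^ q / q ≤ G ^ q := div_le_self (by positivity) hpq.symm.lt.le
    linarith
  have hjump : ∀ k Q F G, 0 < F → 0 < G → φ Q ≤ 4 * K * F → γ Q ≤ 4 * K * G →
      ¬ (φ Q ≤ 4 * F ∧ γ Q ≤ 4 * G) →
      U k Q (if φ Q ≤ 4 * F then F else φ Q) (if γ Q ≤ 4 * G then G else γ Q) ≤ U k Q F G := by
    intro k Q F G hF hG h1 h2 h3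
    have hA := hlow k Q F G hF hG h1 h2
    set F' := if φ Q ≤ 4 * F then F else φ Q with hF'
    set G' := if γ Q ≤ 4 * G then G else γ Q with hG'
    have hFF : F ≤ F' := by
      rw [hF']; split_ifs <;> linarith
    have hGG : G ≤ G' := by
      rw [hG']; split_ifs <;> linarith
    have hD₁ : doobPotential p q c₁ F' (φ Q) (Φ Q) ≤ doobPotential p q c₁ F (φ Q) (Φ Q) := by
      rw [hF']; split_ifs
      · exact le_rfl
      · exact doobPotential_self_le hpq _ _ hF.le (hφ0 Q)
    have hD₂ : doobPotential q p c₂ G' (γ Q) (Γ Q) ≤ doobPotential q p c₂ G (γ Q) (Γ Q) := by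
      rw [hG']; split_ifs
      · exact le_rfl
      · exact doobPotential_self_le hpq.symm _ _ hG.le (hγ0 Q)
    have hprod : 4 * (F * G) ≤ F' * G' := by
      by_cases h4 : φ Q ≤ 4 * F
      · have h5 : ¬ γ Q ≤ 4 * G := fun h => h3 ⟨h4, h⟩
        have h6 : 4 * G ≤ G' := by rw [hG', if_neg h5]; linarith
        calc 4 * (F * G) = F * (4 * G) := by ring
          _ ≤ F' * G' := by gcongr; linarith
      · have h6 : 4 * F ≤ F' := by rw [hF', if_neg h4]; linarith
        calc 4 * (F * G) = 4 * F * G := by ring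
          _ ≤ F' * G' := by gcongr; linarith
    have hB : 0 ≤ G' / F' * (2 * C₀) * l₁ k Q + F' / G' / 2 * l₂ Q := by
      have := hl₁0 k Q
      have := hl₂0 Q
      have : 0 < F' := by linarith
      have : 0 < G' := by linarith
      positivity
    have hC := mul_le_mul_of_nonneg_left (add_le_add hD₁ hD₂)
      (show 0 ≤ 8 / 3 * C₁ by positivity)
    have hE := mul_le_mul_of_nonneg_left hprod (show 0 ≤ C₁ / 3 by positivity)
    simp only [U]
    linarith
  -- No jump: the thresholds are frozen, the Doob potentials are martingales, and the quadratic
  -- terms absorb the form at `Q`.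
  have hdrop : ∀ k Q F G, 0 < F → 0 < G →
      K * paraForm ch b f g Q + ∑ η, U k (ch Q η) F G ≤ K * U (k + 1) Q F G := by
    intro k Q F G hF hG
    have h₁ : K * (l₁ (k + 1) Q + (∑ ν, ‖f ν Q‖ ^ 2 * treeVar ch (b ν) Q) / (4 * C₀)) ≤
        ∑ η, l₁ k (ch Q η) := by
      simp only [l₁]
      rw [Finset.sum_comm, Finset.sum_div, ← Finset.sum_add_distrib, Finset.mul_sum]
      refine Finset.sum_le_sum fun ν _ => ?_
      have hrec : M ν (k + 1) Q =
          treeVar ch (b ν) Q / C₀ + (∑ η, M ν k (ch Q η)) / Fintype.card κ := by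
        simp only [M, treeSum, ← Finset.sum_div]
        field_simp
      have hd := carleson_step (hf ν Q) (fun η => hM0 ν k (ch Q η))
        (div_nonneg (treeVar_nonneg (b ν) Q) hC₀.le) (by rw [← hrec]; exact hM1 ν (k + 1) Q)
      rw [← hrec] at hd
      refine le_trans (le_of_eq ?_) hd
      rw [← hK]
      field_simp
      ring
    have h₂ : ∑ η, l₂ (ch Q η) = K * (l₂ Q + ∑ ν, treeVar ch (g ν) Q) := by
      simp only [l₂]
      rw [Finset.sum_comm, ← Finset.sum_add_distrib, Finset.mul_sum]
      refine Finset.sum_congr rfl fun ν _ => ?_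
      rw [sum_norm_sq_eq_of_sum_eq (hg ν Q), treeVar, ← hK]
      field_simp
    have h₃ := paraForm_le (ch := ch) b f g Q (r := G / F) (s := F / G) (by field_simp)
      (by positivity)
    have h₄ : ∑ η, U k (ch Q η) F G =
        8 / 3 * C₁ * (K * doobPotential p q c₁ F (φ Q) (Φ Q) +
          K * doobPotential q p c₂ G (γ Q) (Γ Q))
        - K * (C₁ / 3 * (F * G)) - G / F * (2 * C₀) * ∑ η, l₁ k (ch Q η)
        - F / G / 2 * ∑ η, l₂ (ch Q η) := by
      simp only [U, Finset.sum_sub_distrib, ← Finset.mul_sum, Finset.sum_add_distrib,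
        hφ.sum_doobPotential hΦ, hγ.sum_doobPotential hΓ, Finset.sum_const, Finset.card_univ,
        nsmul_eq_mul, ← hK]
      ring
    have h₅ := mul_le_mul_of_nonneg_left h₁ (show 0 ≤ G / F * (2 * C₀) by positivity)
    have h₆ := mul_le_mul_of_nonneg_left h₃ hK0.le
    have h₇ : G / F * (2 * C₀) *
        (K * (l₁ (k + 1) Q + (∑ ν, ‖f ν Q‖ ^ 2 * treeVar ch (b ν) Q) / (4 * C₀))) =
        K * (G / F * (2 * C₀) * l₁ (k + 1) Q +
          G / F / 2 * ∑ ν, ‖f ν Q‖ ^ 2 * treeVar ch (b ν) Q) := by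
      field_simp
      ring
    rw [h₄, h₂]
    simp only [U]
    linarith
  have key : ∀ k Q F G, 0 < F → 0 < G → φ Q ≤ 4 * F → γ Q ≤ 4 * G →
      treeSum ch (paraForm ch b f g) k Q ≤ U k Q F G := by
    intro k
    induction k with
    | zero =>
      intro Q F G hF hG h1 h2
      have hA := hlow 0 Q F G hF hG (by nlinarith) (by nlinarith)
      have hB := mul_le_mul_of_nonneg_left (hpot Q F G hF hG) hC₁0.le
      simp only [treeSum, U]
      linarith
    | succ k ih =>
      intro Q F G hF hG h1 h2
      have hchild : ∀ η, treeSum ch (paraForm ch b f g) k (ch Q η) ≤ U k (ch Q η) F G := by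
        intro η
        by_cases h : φ (ch Q η) ≤ 4 * F ∧ γ (ch Q η) ≤ 4 * G
        · exact ih _ F G hF hG h.1 h.2
        · have h3 := le_card_mul_of_martingale hφ hφ0 Q η
          have h4 := le_card_mul_of_martingale hγ hγ0 Q η
          -- Thresholds are reset at the child before the induction hypothesis is applied, so that
          -- it again lies within the factor `4`.
          refine le_trans ?_ (hjump k (ch Q η) F G hF hG (h3.trans (by nlinarith))
            (h4.trans (by nlinarith)) h)
          refine ih _ _ _ ?_ ?_ ?_ ?_
          all_goals
            split_ifs <;> linarith [hφ0 (ch Q η), hγ0 (ch Q η)]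
      have hsum := Finset.sum_le_sum fun η (_ : η ∈ Finset.univ) => hchild η
      have hd := hdrop k Q F G hF hG
      simp only [treeSum]
      rw [← hK]
      refine le_of_mul_le_mul_left ?_ hK0
      refine le_trans ?_ hd
      rw [mul_add, mul_div_cancel₀ _ hK0.ne']
      linarith
  refine (key k Q F G hF hG (by linarith) (by linarith)).trans ?_
  have h1 := doobPotential_le (p := p) (c := c₁) (Φ := Φ Q) hq.le hF.le (hφ0 Q)
  have h2 := doobPotential_le (p := q) (c := c₂) (Φ := Γ Q) hp.le hG.le (hγ0 Q)
  have h3 : 0 ≤ C₁ / 3 * (F * G) + G / F * (2 * C₀) * l₁ k Q + F / G / 2 * l₂ Q := by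
    have := hl₁0 k Q
    have := hl₂0 Q
    positivity
  have h4 : U k Q F G ≤ 8 / 3 * C₁ * ((F ^ p + c₁ * Φ Q) + (G ^ q + c₂ * Γ Q)) := by
    have := mul_le_mul_of_nonneg_left (add_le_add h1 h2) (show 0 ≤ 8 / 3 * C₁ by positivity)
    simp only [U]
    linarith
  refine h4.trans ?_
  rw [mul_assoc (8 / 3 * C₁)]
  gcongr
  have := hΦ0 Q
  have := hΓ0 Q
  have : 0 ≤ F ^ p := by positivity
  have : 0 ≤ G ^ q := by positivity
  have e : (1 + c₁ + c₂) * (F ^ p + Φ Q + G ^ q + Γ Q) - (F ^ p + c₁ * Φ Q + (G ^ q + c₂ * Γ Q)) =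
    c₁ * F ^ p + c₂ * F ^ p + Φ Q + c₂ * Φ Q + c₁ * G ^ q + c₂ * G ^ q + Γ Q + c₁ * Γ Q := by ring
  have : 0 ≤ c₁ * F ^ p + c₂ * F ^ p + Φ Q + c₂ * Φ Q + c₁ * G ^ q + c₂ * G ^ q + Γ Q + c₁ * Γ Q := by
    positivity
  linarith

end Tree

/-! ### Square functions of finite families. -/

/-- The Euclidean norm of a finite family of scalars. -/
def l2Norm {ι 𝕜 : Type*} [Fintype ι] [RCLike 𝕜] (a : ι → 𝕜) : ℝ :=
  Real.sqrt (∑ ν, ‖a ν‖ ^ 2)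

section L2Norm

variable {ι 𝕜 : Type*} [Fintype ι] [RCLike 𝕜]

theorem l2Norm_nonneg (a : ι → 𝕜) : 0 ≤ l2Norm a := Real.sqrt_nonneg _

theorem sq_l2Norm (a : ι → 𝕜) : l2Norm a ^ 2 = ∑ ν, ‖a ν‖ ^ 2 :=
  Real.sq_sqrt (Finset.sum_nonneg fun _ _ => sq_nonneg _)

theorem norm_le_l2Norm (a : ι → 𝕜) (ν : ι) : ‖a ν‖ ≤ l2Norm a :=
  Real.le_sqrt_of_sq_le
    (Finset.single_le_sum (f := fun ν => ‖a ν‖ ^ 2) (fun _ _ => sq_nonneg _) (Finset.mem_univ ν))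

theorem l2Norm_le_sum (a : ι → 𝕜) : l2Norm a ≤ ∑ ν, ‖a ν‖ := by
  refine Real.sqrt_le_iff.2 ⟨Finset.sum_nonneg fun _ _ => norm_nonneg _, ?_⟩
  exact Finset.sum_sq_le_sq_sum_of_nonneg fun _ _ => norm_nonneg _

theorem norm_sum_mul_le_l2Norm (a b : ι → 𝕜) : ‖∑ ν, a ν * b ν‖ ≤ l2Norm a * l2Norm b := by
  refine (norm_sum_le _ _).trans ?_
  simp_rw [norm_mul]
  exact Real.sum_mul_le_sqrt_mul_sqrt _ _ _

theorem l2Norm_smul (c : ℝ) (hc : 0 ≤ c) (a : ι → 𝕜) :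
    l2Norm (fun ν => (c : 𝕜) * a ν) = c * l2Norm a := by
  simp only [l2Norm, norm_mul, mul_pow, ← Finset.mul_sum, RCLike.norm_ofReal, sq_abs]
  rw [Real.sqrt_mul (sq_nonneg c), Real.sqrt_sq hc]

theorem measurable_l2Norm : Measurable (l2Norm : (ι → 𝕜) → ℝ) := by
  unfold l2Norm; fun_prop

variable {α : Type*} [MeasurableSpace α] {μ : Measure α}

theorem MemLp.l2Norm {f : ι → α → 𝕜} {p : ℝ≥0∞} (hf : ∀ ν, MemLp (f ν) p μ) :
    MemLp (fun x => l2Norm fun ν => f ν x) p μ := by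
  refine MemLp.mono' (memLp_finsetSum Finset.univ fun ν _ => (hf ν).norm)
    (g := fun x => ∑ ν, ‖f ν x‖) ?_ ?_
  · exact (measurable_l2Norm.comp_aemeasurable
      (aemeasurable_pi_lambda _ fun ν => (hf ν).1.aemeasurable)).aestronglyMeasurable
  · refine Filter.Eventually.of_forall fun x => ?_
    rw [Real.norm_of_nonneg (l2Norm_nonneg _)]
    exact l2Norm_le_sum _

/-- Minkowski's inequality for the Euclidean norm. -/
theorem l2Norm_average_le [IsFiniteMeasure μ] {f : ι → α → 𝕜} (hf : ∀ ν, Integrable (f ν) μ) :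
    l2Norm (fun ν => ⨍ x, f ν x ∂μ) ≤ ⨍ x, l2Norm (fun ν => f ν x) ∂μ := by
  set a : ι → 𝕜 := fun ν => ⨍ x, f ν x ∂μ with ha
  have hF : Integrable (fun x => l2Norm fun ν => f ν x) μ :=
    memLp_one_iff_integrable.1 (MemLp.l2Norm fun ν => memLp_one_iff_integrable.2 (hf ν))
  -- The vector of averages is paired with itself; one factor of its norm is cancelled at the end.
  have h1 : ((l2Norm a ^ 2 : ℝ) : 𝕜) = ⨍ x, ∑ ν, (starRingEnd 𝕜) (a ν) * f ν x ∂μ := by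
    rw [average_eq, integral_finsetSum _ fun ν _ => (hf ν).const_mul _, sq_l2Norm,
      Finset.smul_sum]
    push_cast
    refine Finset.sum_congr rfl fun ν _ => ?_
    rw [integral_const_mul, ← mul_smul_comm, ← average_eq, RCLike.conj_mul]
  have h2 : l2Norm a ^ 2 ≤ l2Norm a * ⨍ x, l2Norm (fun ν => f ν x) ∂μ := by
    calc l2Norm a ^ 2 = ‖((l2Norm a ^ 2 : ℝ) : 𝕜)‖ := by
          rw [RCLike.norm_ofReal, abs_of_nonneg (sq_nonneg _)]
      _ = ‖⨍ x, ∑ ν, (starRingEnd 𝕜) (a ν) * f ν x ∂μ‖ := by rw [h1]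
      _ ≤ ⨍ x, ‖∑ ν, (starRingEnd 𝕜) (a ν) * f ν x‖ ∂μ := by
          rw [average_eq, average_eq, norm_smul, smul_eq_mul, Real.norm_of_nonneg (by positivity)]
          gcongr
          exact norm_integral_le_integral_norm _
      _ ≤ ⨍ x, l2Norm a * l2Norm (fun ν => f ν x) ∂μ := by
          rw [average_eq, average_eq, smul_eq_mul, smul_eq_mul]
          refine mul_le_mul_of_nonneg_left (integral_mono ?_ (hF.const_mul _) fun x => ?_)
            (by positivity)
          · exact (integrable_finsetSum _ fun ν _ => (hf ν).const_mul _).norm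
          · refine (norm_sum_mul_le_l2Norm _ _).trans_eq ?_
            simp [l2Norm]
      _ = _ := by
          rw [average_eq, average_eq, integral_const_mul, smul_eq_mul, smul_eq_mul]
          ring
  rcases (l2Norm_nonneg a).eq_or_lt with h0 | h0
  · rw [← h0, average_eq]
    exact mul_nonneg (by positivity) (integral_nonneg fun x => l2Norm_nonneg _)
  · rw [sq] at h2
    exact le_of_mul_le_mul_left h2 h0

end L2Norm

/-! ### Geometry of the dyadic grid, and averages as tree martingales. -/

namespace DyadicGrid

variable {m : ℕ} {𝕜 : Type*} [RCLike 𝕜] (D : DyadicGrid m)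

/-- Reduces nesting and disjointness of cubes to integer arithmetic. -/
theorem mem_cube_iff {Q : CubeIndex m} {x : Fin m → ℝ} :
    x ∈ D.cube Q ↔ ∀ j, ⌊(2 : ℝ) ^ Q.1 * (x j - D.origin Q.1 j)⌋ = Q.2 j := by
  simp only [cube, Set.mem_univ_pi, Set.mem_Ico, Int.floor_eq_iff]
  refine forall_congr' fun j => ?_
  have h : (0 : ℝ) < 2 ^ Q.1 := by positivity
  rw [zpow_neg, ← sub_nonneg, ← sub_pos, ← sub_nonneg (b := (Q.2 j : ℝ)),
    ← sub_pos (b := (2 : ℝ) ^ Q.1 * _)]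
  refine and_congr ?_ ?_
  · rw [← mul_nonneg_iff_of_pos_left h]
    field_simp
    constructor <;> intro h <;> linarith
  · rw [← mul_pos_iff_of_pos_left h]
    field_simp
    constructor <;> intro h <;> linarith

theorem volume_real_cube (Q : CubeIndex m) :
    volume.real (D.cube Q) = ((2 : ℝ) ^ (-Q.1)) ^ m := by
  have h : (0 : ℝ) < 2 ^ (-Q.1) := by positivity
  rw [Measure.real, cube, volume_pi_pi, ENNReal.toReal_prod]
  simp only [Real.volume_Ico]
  rw [Finset.prod_congr rfl fun j _ => ?_, Finset.prod_const, Finset.card_univ, Fintype.card_fin]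
  rw [ENNReal.toReal_ofReal] <;> ring_nf
  exact h.le

theorem volume_real_cube_pos (Q : CubeIndex m) : 0 < volume.real (D.cube Q) := by
  rw [volume_real_cube]; positivity

theorem volume_real_cube_eq (Q : CubeIndex m) (η : Fin m → Fin 2) :
    volume.real (D.cube Q) =
      Fintype.card (Fin m → Fin 2) * volume.real (D.cube (D.child Q η)) := by
  rw [volume_real_cube, volume_real_cube]
  simp only [child, Fintype.card_pi, Fintype.card_fin, Finset.prod_const, Finset.card_univ,
    Nat.cast_pow, Nat.cast_ofNat]
  rw [← mul_pow, neg_add, zpow_add₀ two_ne_zero]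
  congr 1
  norm_num
  ring

theorem child_injective (Q : CubeIndex m) : Function.Injective (D.child Q) := by
  intro η η' h
  funext j
  have := congrFun (congrArg Prod.snd h) j
  simp only [child] at this
  omega

theorem exists_child_eq (i : ℤ) (v : Fin m → ℤ) : ∃ w η, D.child (i, w) η = (i + 1, v) := by
  refine ⟨fun j => (v j - D.step i j) / 2,
    fun j => if (v j - D.step i j) % 2 = 0 then 0 else 1, ?_⟩
  simp only [child, Prod.mk.injEq, true_and]
  funext j
  split_ifs with h
  · simp; omega
  · simp; omega

theorem mem_cube_child_iff {Q : CubeIndex m} {x : Fin m → ℝ} :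
    x ∈ D.cube Q ↔ ∃ η, x ∈ D.cube (D.child Q η) := by
  -- Passing to the parent subtracts the step and halves the integer position, rounding down.
  have key : ∀ j, ⌊(2 : ℝ) ^ Q.1 * (x j - D.origin Q.1 j)⌋ =
      (⌊(2 : ℝ) ^ (Q.1 + 1) * (x j - D.origin (Q.1 + 1) j)⌋ - D.step Q.1 j) / 2 := by
    intro j
    have h : (2 : ℝ) ^ Q.1 * (x j - D.origin Q.1 j) =
        ((2 : ℝ) ^ (Q.1 + 1) * (x j - D.origin (Q.1 + 1) j) - (D.step Q.1 j : ℝ)) / (2 : ℕ) := by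
      rw [D.nested, neg_add, zpow_add₀ two_ne_zero, zpow_add₀ two_ne_zero, zpow_neg]
      field_simp
      push_cast
      ring
    rw [h, Int.floor_div_natCast, Int.floor_sub_intCast]
    norm_num
  simp only [mem_cube_iff, child, key]
  constructor
  · intro h
    refine ⟨fun j => if (⌊(2 : ℝ) ^ (Q.1 + 1) * (x j - D.origin (Q.1 + 1) j)⌋ - D.step Q.1 j) % 2
      = 0 then 0 else 1, fun j => ?_⟩
    have := h j
    dsimp only
    split_ifs with h
    · simp; omega
    · simp; omega
  · rintro ⟨η, h⟩ j
    rw [h j]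
    have : (η j : ℕ) < 2 := (η j).2
    omega

theorem cube_eq_iUnion (Q : CubeIndex m) : D.cube Q = ⋃ η, D.cube (D.child Q η) := by
  ext x
  rw [Set.mem_iUnion, mem_cube_child_iff]

theorem disjoint_cube {i : ℤ} {v w : Fin m → ℤ} (h : v ≠ w) :
    Disjoint (D.cube (i, v)) (D.cube (i, w)) := by
  rw [Set.disjoint_left]
  intro x hx hy
  rw [mem_cube_iff] at hx hy
  exact h (funext fun j => (hx j).symm.trans (hy j))

theorem disjoint_cube_child (Q : CubeIndex m) :
    Pairwise (Function.onFun Disjoint fun η => D.cube (D.child Q η)) := by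
  intro η η' h
  refine D.disjoint_cube fun h' => h (D.child_injective Q (Prod.ext rfl h'))

theorem _root_.MeasureTheory.LocallyIntegrable.integrableOn_cube {E : Type*}
    [NormedAddCommGroup E] {f : (Fin m → ℝ) → E} (hf : LocallyIntegrable f volume)
    (Q : CubeIndex m) : IntegrableOn f (D.cube Q) volume := by
  refine (hf.integrableOn_isCompact (isCompact_univ_pi fun j => isCompact_Icc
    (a := D.origin Q.1 j + (2 : ℝ) ^ (-Q.1) * (Q.2 j : ℝ))
    (b := D.origin Q.1 j + (2 : ℝ) ^ (-Q.1) * ((Q.2 j : ℝ) + 1)))).mono_set ?_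
  exact Set.pi_mono fun j _ => Set.Ico_subset_Icc_self

instance isFiniteMeasure_restrict_cube (Q : CubeIndex m) :
    IsFiniteMeasure (volume.restrict (D.cube Q)) :=
  ⟨by simpa using (D.volume_cube_ne_top Q).lt_top⟩

instance neZero_restrict_cube (Q : CubeIndex m) : NeZero (volume.restrict (D.cube Q)) :=
  ⟨fun h => by
    have := D.volume_real_cube_pos Q
    rw [Measure.restrict_eq_zero] at h
    simp [Measure.real, h] at this⟩

theorem volume_smul_avg (f : (Fin m → ℝ) → 𝕜) (Q : CubeIndex m) :
    volume.real (D.cube Q) • D.avg f Q = ∫ x in D.cube Q, f x := by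
  rw [avg, setAverage_eq, smul_inv_smul₀ (D.volume_real_cube_pos Q).ne']

theorem isTreeMartingale_avg {f : (Fin m → ℝ) → 𝕜} (hf : LocallyIntegrable f volume) :
    IsTreeMartingale D.child (D.avg f) := by
  intro Q
  have h1 := D.volume_smul_avg f Q
  rw [D.cube_eq_iUnion, integral_iUnion_fintype (fun η => D.measurableSet_cube _)
    (D.disjoint_cube_child Q) (fun η => hf.integrableOn_cube D _), ← D.cube_eq_iUnion] at h1
  simp_rw [← D.volume_smul_avg] at h1
  have h2 : ∀ η, volume.real (D.cube (D.child Q η)) = volume.real (D.cube (D.child Q 0)) :=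
    fun η => by rw [volume_real_cube, volume_real_cube]; rfl
  simp_rw [h2, ← Finset.smul_sum] at h1
  rw [D.volume_real_cube_eq Q 0, mul_comm, mul_smul] at h1
  exact (smul_right_injective _ (D.volume_real_cube_pos (D.child Q 0)).ne' h1).symm

theorem avg_nonneg {f : (Fin m → ℝ) → ℝ} (h : ∀ x, 0 ≤ f x) (Q : CubeIndex m) :
    0 ≤ D.avg f Q := by
  rw [avg, setAverage_eq]
  exact smul_nonneg (by positivity) (integral_nonneg h)

theorem norm_avg_sub_le {f : (Fin m → ℝ) → 𝕜} (hf : LocallyIntegrable f volume) (c : 𝕜)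
    (Q : CubeIndex m) : ‖D.avg f Q - c‖ ≤ D.avg (fun x => ‖f x - c‖) Q := by
  have h : D.avg f Q - c = D.avg (fun x => f x - c) Q := by
    rw [avg, avg, setAverage_eq, setAverage_eq,
      integral_sub (hf.integrableOn_cube D Q) (integrable_const c), smul_sub]
    congr 1
    rw [← setAverage_eq, average_const]
  rw [h, avg, avg, setAverage_eq, setAverage_eq, norm_smul, smul_eq_mul,
    Real.norm_of_nonneg (by positivity)]
  gcongr
  exact norm_integral_le_integral_norm _

theorem avg_norm_sub_le_one {b : (Fin m → ℝ) → 𝕜} (hb : LocallyIntegrable b volume)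
    (h : D.bmoNorm b ≤ 1) (Q : CubeIndex m) : D.avg (fun x => ‖b x - D.avg b Q‖) Q ≤ 1 := by
  have h1 : ⨍⁻ x in D.cube Q, ‖b x - D.avg b Q‖ₑ ∂volume ≤ 1 := (le_iSup _ Q).trans h
  have hm : AEMeasurable (fun x => ‖b x - D.avg b Q‖ₑ) (volume.restrict (D.cube Q)) :=
    ((hb.aestronglyMeasurable.sub aestronglyMeasurable_const).restrict).enorm
  have h2 := toReal_laverage hm (Filter.Eventually.of_forall fun x => enorm_ne_top)
  simp only [toReal_enorm] at h2
  rw [avg, ← h2]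
  exact ENNReal.toReal_le_of_le_ofReal zero_le_one (by simpa using h1)

/-- The dominating martingale for the root `R` consists of the averages of `|b - ⟨b⟩_R|`. The BMO
bound enters only through its value at `R` itself. -/
theorem treeSum_treeVar_avg_le {b : (Fin m → ℝ) → 𝕜} (hb : LocallyIntegrable b volume)
    (h : D.bmoNorm b ≤ 1) (k : ℕ) (Q : CubeIndex m) :
    treeSum D.child (treeVar D.child (D.avg b)) k Q ≤
      4 * (Fintype.card (Fin m → Fin 2) : ℝ) ^ 2 :=
  treeSum_treeVar_le (D.isTreeMartingale_avg hb)
    (β := fun R => D.avg fun x => ‖b x - D.avg b R‖)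
    (fun R => D.isTreeMartingale_avg <|
      LocallyIntegrable.mono (hb.sub (locallyIntegrable_const (D.avg b R)))
        (hb.aestronglyMeasurable.sub aestronglyMeasurable_const).norm
        (Filter.Eventually.of_forall fun _ => (norm_norm _).le))
    (fun _ Q => D.norm_avg_sub_le hb _ Q) (fun R => D.avg_norm_sub_le_one hb h R) k Q

theorem rpow_avg_le {f : (Fin m → ℝ) → ℝ} (hf0 : ∀ x, 0 ≤ f x) {p : ℝ} (hp : 1 ≤ p)
    (hf : LocallyIntegrable f volume) (hfp : LocallyIntegrable (fun x => f x ^ p) volume)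
    (Q : CubeIndex m) : D.avg f Q ^ p ≤ D.avg (fun x => f x ^ p) Q :=
  (convexOn_rpow hp).map_average_le (Real.continuous_rpow_const (by linarith)).continuousOn
    isClosed_Ici (Filter.Eventually.of_forall hf0) (hf.integrableOn_cube D Q)
    (hfp.integrableOn_cube D Q)

end DyadicGrid

/-! ### The dual form of the partial sums and its bound. -/

namespace DyadicGrid

variable {m : ℕ} {𝕜 : Type*} [RCLike 𝕜] (D : DyadicGrid m)

/-- The partial sum over `s` of the paraproduct of `f` with symbol `b`. -/
def partialPara (b f : (Fin m → ℝ) → 𝕜) (s : Finset (CubeIndex m)) (x : Fin m → ℝ) : 𝕜 :=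
  ∑ Q ∈ s, D.avg f Q * D.martingaleDiff b Q x

theorem memLp_partialPara (b f : (Fin m → ℝ) → 𝕜) (s : Finset (CubeIndex m)) (p : ℝ≥0∞) :
    MemLp (D.partialPara b f s) p volume :=
  memLp_finsetSum s fun Q _ => (D.memLp_martingaleDiff b Q p).const_mul (D.avg f Q)

theorem integrable_martingaleDiff_mul (b : (Fin m → ℝ) → 𝕜) {g : (Fin m → ℝ) → 𝕜}
    (hg : LocallyIntegrable g volume) (Q : CubeIndex m) :
    Integrable (fun x => D.martingaleDiff b Q x * g x) volume := by
  simp only [martingaleDiff, Finset.sum_mul]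
  refine integrable_finsetSum _ fun η _ => ?_
  simp_rw [← Set.indicator_mul_left]
  rw [integrable_indicator_iff (D.measurableSet_cube _)]
  exact (hg.integrableOn_cube D _).const_mul _

theorem integral_martingaleDiff_mul {b g : (Fin m → ℝ) → 𝕜} (hb : LocallyIntegrable b volume)
    (hg : LocallyIntegrable g volume) (Q : CubeIndex m) :
    ∫ x, D.martingaleDiff b Q x * g x = (volume.real (D.cube Q) : 𝕜) *
      ((∑ η, (D.avg b (D.child Q η) - D.avg b Q) * (D.avg g (D.child Q η) - D.avg g Q)) /
        (Fintype.card (Fin m → Fin 2) : 𝕜)) := by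
  -- This cancellation allows `⟨g⟩_Q` to be subtracted from the averages of `g`.
  have h0 : ∑ η, (D.avg b (D.child Q η) - D.avg b Q) = 0 := by
    rw [Finset.sum_sub_distrib, D.isTreeMartingale_avg hb Q]
    rw [RCLike.real_smul_eq_coe_mul, Finset.sum_const, Finset.card_univ, nsmul_eq_mul]
    push_cast
    exact sub_self _
  have h1 : ∀ η, ∫ x, (D.cube (D.child Q η)).indicator
      (fun _ => D.avg b (D.child Q η) - D.avg b Q) x * g x =
      (volume.real (D.cube Q) : 𝕜) * ((D.avg b (D.child Q η) - D.avg b Q) *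
        D.avg g (D.child Q η)) / (Fintype.card (Fin m → Fin 2) : 𝕜) := by
    intro η
    simp_rw [← Set.indicator_mul_left]
    rw [integral_indicator (D.measurableSet_cube _), integral_const_mul, ← D.volume_smul_avg,
      D.volume_real_cube_eq Q η, RCLike.real_smul_eq_coe_mul]
    have : (Fintype.card (Fin m → Fin 2) : 𝕜) ≠ 0 := by simp
    field_simp
    push_cast
    ring
  simp only [martingaleDiff, Finset.sum_mul]
  rw [integral_finsetSum]
  · simp_rw [h1, mul_sub, Finset.sum_sub_distrib, ← Finset.sum_mul, h0, zero_mul, sub_zero,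
      ← Finset.sum_div, ← Finset.mul_sum, mul_div_assoc]
  · intro η _
    simp_rw [← Set.indicator_mul_left]
    rw [integrable_indicator_iff (D.measurableSet_cube _)]
    exact (hg.integrableOn_cube D _).const_mul _

theorem norm_sum_integral_partialPara_mul_le {ι : Type} [Fintype ι]
    {b f g : ι → (Fin m → ℝ) → 𝕜} (hb : ∀ ν, LocallyIntegrable (b ν) volume)
    (hg : ∀ ν, LocallyIntegrable (g ν) volume) (s : Finset (CubeIndex m)) :
    ‖∑ ν, ∫ x, D.partialPara (b ν) (f ν) s x * g ν x‖ ≤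
      ∑ Q ∈ s, volume.real (D.cube Q) * paraForm D.child (fun ν => D.avg (b ν))
        (fun ν => D.avg (f ν)) (fun ν => D.avg (g ν)) Q := by
  have h : ∀ ν, ∫ x, D.partialPara (b ν) (f ν) s x * g ν x =
      ∑ Q ∈ s, D.avg (f ν) Q * ∫ x, D.martingaleDiff (b ν) Q x * g ν x := by
    intro ν
    simp only [partialPara, Finset.sum_mul, mul_assoc]
    rw [integral_finsetSum _ fun Q _ =>
      (D.integrable_martingaleDiff_mul (b ν) (hg ν) Q).const_mul _]
    simp_rw [integral_const_mul]
  simp_rw [h]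
  rw [Finset.sum_comm]
  refine (norm_sum_le _ _).trans (Finset.sum_le_sum fun Q _ => ?_)
  refine (norm_sum_le _ _).trans ?_
  rw [paraForm, Finset.mul_sum]
  refine Finset.sum_le_sum fun ν _ => ?_
  rw [D.integral_martingaleDiff_mul (hb ν) (hg ν), norm_mul, norm_mul, norm_div,
    RCLike.norm_ofReal, abs_of_nonneg measureReal_nonneg, RCLike.norm_natCast, mul_left_comm]
  gcongr
  refine (norm_sum_le _ _).trans_eq ?_
  simp_rw [norm_mul]

/-- A finite set of cubes need not have a common ancestor, so the trees are rooted at finitely many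
cubes of the coarsest generation. A child has the fraction of the volume of its parent by which
`treeSum` weights it. -/
theorem exists_sum_le_sum_treeSum {a : CubeIndex m → ℝ} (ha : ∀ Q, 0 ≤ a Q) (k : ℕ) (i : ℤ)
    (s : Finset (CubeIndex m)) (hs : ∀ Q ∈ s, i ≤ Q.1 ∧ Q.1 < i + k) :
    ∃ t : Finset (Fin m → ℤ), ∑ Q ∈ s, volume.real (D.cube Q) * a Q ≤
      ∑ v ∈ t, volume.real (D.cube (i, v)) * treeSum D.child a k (i, v) := by
  classical
  induction k generalizing i s with
  | zero =>
    refine ⟨∅, ?_⟩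
    rw [Finset.eq_empty_of_forall_notMem (s := s)]
    · simp
    · intro Q hQ
      have := hs Q hQ
      simp at this
      omega
  | succ k ih =>
    obtain ⟨t, ht⟩ := ih (i + 1) (s.filter fun Q => Q.1 ≠ i) (by
      intro Q hQ
      rw [Finset.mem_filter] at hQ
      have := hs Q hQ.1
      push_cast at this
      have := hQ.2
      omega)
    choose w η hw using D.exists_child_eq i
    -- The parents of the roots found one generation below, together with the cubes of `s` already
    -- at generation `i`.
    let t' : Finset (Fin m → ℤ) := t.image w ∪ (s.filter fun Q => Q.1 = i).image Prod.snd
    refine ⟨t', ?_⟩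
    have hT : ∀ k Q, 0 ≤ treeSum D.child a k Q := treeSum_nonneg ha
    have h1 : ∑ Q ∈ s.filter (fun Q => Q.1 = i), volume.real (D.cube Q) * a Q ≤
        ∑ v ∈ t', volume.real (D.cube (i, v)) * a (i, v) := by
      have hinj : Set.InjOn Prod.snd (s.filter fun Q => Q.1 = i : Set (CubeIndex m)) := by
        intro Q hQ Q' hQ' h
        simp only [Finset.coe_filter, Set.mem_ofPred_eq] at hQ hQ'
        exact Prod.ext (hQ.2.trans hQ'.2.symm) h
      calc _ = ∑ v ∈ (s.filter fun Q => Q.1 = i).image Prod.snd,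
            volume.real (D.cube (i, v)) * a (i, v) := by
            rw [Finset.sum_image (by exact_mod_cast hinj)]
            refine Finset.sum_congr rfl fun Q hQ => ?_
            rw [← (Finset.mem_filter.1 hQ).2]
        _ ≤ _ := Finset.sum_le_sum_of_subset_of_nonneg Finset.subset_union_right
            fun v _ _ => mul_nonneg measureReal_nonneg (ha _)
    have h2 : ∑ v ∈ t, volume.real (D.cube (i + 1, v)) * treeSum D.child a k (i + 1, v) ≤
        ∑ w ∈ t', ∑ η, volume.real (D.cube (D.child (i, w) η)) *
          treeSum D.child a k (D.child (i, w) η) := by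
      rw [← Finset.sum_product' (s := t') (t := Finset.univ) (f := fun w η =>
        volume.real (D.cube (D.child (i, w) η)) * treeSum D.child a k (D.child (i, w) η))]
      have hinj : Function.Injective fun v => (w v, η v) := fun v v' h => by
        have h' := hw v
        rw [show w v = w v' from congrArg Prod.fst h, show η v = η v' from congrArg Prod.snd h,
          hw v'] at h'
        exact (congrArg Prod.snd h').symm
      calc _ = ∑ x ∈ t.image fun v => (w v, η v), volume.real (D.cube (D.child (i, x.1) x.2)) *
            treeSum D.child a k (D.child (i, x.1) x.2) := by
            rw [Finset.sum_image hinj.injOn]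
            simp only [hw]
        _ ≤ _ := by
            refine Finset.sum_le_sum_of_subset_of_nonneg ?_
              fun x _ _ => mul_nonneg measureReal_nonneg (hT _ _)
            intro x hx
            obtain ⟨v, hv, rfl⟩ := Finset.mem_image.1 hx
            exact Finset.mem_product.2
              ⟨Finset.mem_union_left _ (Finset.mem_image_of_mem w hv), Finset.mem_univ _⟩
    have h3 : ∀ v, volume.real (D.cube (i, v)) * treeSum D.child a (k + 1) (i, v) =
        volume.real (D.cube (i, v)) * a (i, v) +
        ∑ η, volume.real (D.cube (D.child (i, v) η)) *
          treeSum D.child a k (D.child (i, v) η) := by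
      intro v
      rw [treeSum, mul_add, Finset.sum_div, Finset.mul_sum]
      congr 1
      refine Finset.sum_congr rfl fun η _ => ?_
      have : (Fintype.card (Fin m → Fin 2) : ℝ) ≠ 0 := by simp
      rw [D.volume_real_cube_eq (i, v) η]
      field_simp
    simp_rw [h3, Finset.sum_add_distrib]
    rw [← Finset.sum_filter_add_sum_filter_not s (fun Q => Q.1 = i)]
    exact add_le_add h1 (ht.trans h2)

theorem exists_generations (s : Finset (CubeIndex m)) :
    ∃ (i : ℤ) (k : ℕ), ∀ Q ∈ s, i ≤ Q.1 ∧ Q.1 < i + k := by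
  induction s using Finset.induction with
  | empty => exact ⟨0, 0, by simp⟩
  | insert Q s _ ih =>
    obtain ⟨i, k, h⟩ := ih
    refine ⟨min i Q.1, (max (i + k) (Q.1 + 1) - min i Q.1).toNat, fun R hR => ?_⟩
    rcases Finset.mem_insert.1 hR with rfl | hR
    · omega
    · have := h R hR
      omega

theorem paraForm_nonneg {I κ ι : Type} [Fintype κ] [Fintype ι] {ch : I → κ → I}
    (b f g : ι → I → 𝕜) (Q : I) : 0 ≤ paraForm ch b f g Q := by
  unfold paraForm; positivity

theorem sum_volume_mul_avg_le {h : (Fin m → ℝ) → ℝ} (h0 : ∀ x, 0 ≤ h x)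
    (hh : Integrable h volume) (i : ℤ) (t : Finset (Fin m → ℤ)) :
    ∑ v ∈ t, volume.real (D.cube (i, v)) * D.avg h (i, v) ≤ ∫ x, h x := by
  simp_rw [← smul_eq_mul, D.volume_smul_avg]
  rw [← integral_biUnion_finset t (fun v _ => D.measurableSet_cube _)
    (fun v _ w _ hvw => D.disjoint_cube hvw) fun v _ => hh.integrableOn]
  exact setIntegral_le_integral hh (Filter.Eventually.of_forall h0)

theorem exists_norm_sum_integral_partialPara_le (m : ℕ) (𝕜 : Type*) [RCLike 𝕜] {p q : ℝ}
    (hpq : p.HolderConjugate q) :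
    ∃ C : ℝ, 0 < C ∧ ∀ (D : DyadicGrid m) {ι : Type} [Fintype ι]
      {b f g : ι → (Fin m → ℝ) → 𝕜}, (∀ ν, LocallyIntegrable (b ν) volume) →
      (∀ ν, D.bmoNorm (b ν) ≤ 1) → (∀ ν, MemLp (f ν) (ENNReal.ofReal p) volume) →
      (∀ ν, MemLp (g ν) (ENNReal.ofReal q) volume) → ∀ s : Finset (CubeIndex m),
      ‖∑ ν, ∫ x, D.partialPara (b ν) (f ν) s x * g ν x‖ ≤
        C * ((∫ x, l2Norm (fun ν => f ν x) ^ p) + ∫ x, l2Norm (fun ν => g ν x) ^ q) := by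
  obtain ⟨C, hC, key⟩ := exists_treeSum_paraForm_le (κ := Fin m → Fin 2) (𝕜 := 𝕜) hpq
    (4 * (Fintype.card (Fin m → Fin 2) : ℝ) ^ 2) (by simp)
  refine ⟨2 * C, by positivity, fun D ι _ b f g hb hbmo hf hg s => ?_⟩
  have loc : ∀ {r : ℝ}, 1 < r → ∀ {h : (Fin m → ℝ) → 𝕜},
      MemLp h (ENNReal.ofReal r) volume → LocallyIntegrable h volume := fun hr _ hh =>
    hh.locallyIntegrable (by simpa using hr.le)
  have loc_l2 : ∀ {r : ℝ}, 1 < r → ∀ {h : ι → (Fin m → ℝ) → 𝕜},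
      (∀ ν, MemLp (h ν) (ENNReal.ofReal r) volume) →
      LocallyIntegrable (fun x => l2Norm fun ν => h ν x) volume := fun hr _ hh =>
    (MemLp.l2Norm hh).locallyIntegrable (by simpa using hr.le)
  have pow_int : ∀ {r : ℝ}, 1 < r → ∀ {h : ι → (Fin m → ℝ) → 𝕜},
      (∀ ν, MemLp (h ν) (ENNReal.ofReal r) volume) →
      Integrable (fun x => l2Norm (fun ν => h ν x) ^ r) volume := by
    intro r hr h hh
    have := (MemLp.l2Norm hh).integrable_norm_rpow (by simp; linarith) ENNReal.ofReal_ne_top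
    rw [ENNReal.toReal_ofReal (by linarith)] at this
    simpa only [Real.norm_of_nonneg (l2Norm_nonneg _)] using this
  have hp := hpq.lt
  have hq := hpq.symm.lt
  have hl2 : ∀ {h : ι → (Fin m → ℝ) → 𝕜}, (∀ ν, LocallyIntegrable (h ν) volume) → ∀ Q,
      ∑ ν, ‖D.avg (h ν) Q‖ ^ 2 ≤ D.avg (fun x => l2Norm fun ν => h ν x) Q ^ 2 := by
    intro h hh Q
    rw [← sq_l2Norm fun ν => D.avg (h ν) Q]
    refine pow_le_pow_left₀ (l2Norm_nonneg _) ?_ 2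
    exact l2Norm_average_le fun ν => (hh ν).integrableOn_cube D Q
  refine (D.norm_sum_integral_partialPara_mul_le hb (fun ν => loc hq (hg ν)) s).trans ?_
  obtain ⟨i, k, hik⟩ := exists_generations s
  obtain ⟨t, ht⟩ := D.exists_sum_le_sum_treeSum (fun Q => paraForm_nonneg (ch := D.child)
    (fun ν => D.avg (b ν)) (fun ν => D.avg (f ν)) (fun ν => D.avg (g ν)) Q) k i s hik
  refine ht.trans ?_
  have iP := pow_int hp hf
  have iQ := pow_int hq hg
  have hφΦ := D.rpow_avg_le (fun x => l2Norm_nonneg fun ν => f ν x) hp.le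
    (loc_l2 hp hf) iP.locallyIntegrable
  have hγΓ := D.rpow_avg_le (fun x => l2Norm_nonneg fun ν => g ν x) hq.le
    (loc_l2 hq hg) iQ.locallyIntegrable
  have hφ0 := D.avg_nonneg (fun x => l2Norm_nonneg fun ν => f ν x)
  have hγ0 := D.avg_nonneg (fun x => l2Norm_nonneg fun ν => g ν x)
  set φ := D.avg fun x => l2Norm fun ν => f ν x
  set γ := D.avg fun x => l2Norm fun ν => g ν x
  set Φ := D.avg fun x => l2Norm (fun ν => f ν x) ^ p with hΦ
  set Γ := D.avg fun x => l2Norm (fun ν => g ν x) ^ q with hΓ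
  -- The thresholds are `(Φ + ε / 2) ^ p⁻¹` and `(Γ + ε / 2) ^ q⁻¹`: by Jensen they dominate `φ` and
  -- `γ`, and `ε` keeps them positive where `Φ` or `Γ` vanishes.
  have hkey : ∀ Q, ∀ ε > 0, treeSum D.child (paraForm D.child (fun ν => D.avg (b ν))
      (fun ν => D.avg (f ν)) (fun ν => D.avg (g ν))) k Q ≤ C * (2 * Φ Q + 2 * Γ Q + ε) := by
    intro Q ε hε
    have hΦ0 : 0 ≤ Φ Q := (Real.rpow_nonneg (hφ0 Q) p).trans (hφΦ Q)
    have hΓ0 : 0 ≤ Γ Q := (Real.rpow_nonneg (hγ0 Q) q).trans (hγΓ Q)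
    have := key (fun ν => D.isTreeMartingale_avg (loc hp (hf ν)))
      (fun ν => D.isTreeMartingale_avg (loc hq (hg ν)))
      (D.isTreeMartingale_avg (loc_l2 hp hf))
      (D.isTreeMartingale_avg iP.locallyIntegrable)
      (D.isTreeMartingale_avg (loc_l2 hq hg))
      (D.isTreeMartingale_avg iQ.locallyIntegrable)
      hφ0 hγ0 (hl2 fun ν => loc hp (hf ν)) (hl2 fun ν => loc hq (hg ν)) hφΦ hγΓ
      (fun ν => D.treeSum_treeVar_avg_le (hb ν) (hbmo ν)) k Q
      ((Φ Q + ε / 2) ^ p⁻¹) ((Γ Q + ε / 2) ^ q⁻¹) (by positivity) (by positivity)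
      ((Real.le_rpow_inv_iff_of_pos (hφ0 Q) (by positivity) hpq.pos).2
        ((hφΦ Q).trans (by linarith)))
      ((Real.le_rpow_inv_iff_of_pos (hγ0 Q) (by positivity) hpq.symm.pos).2
        ((hγΓ Q).trans (by linarith)))
    rw [Real.rpow_inv_rpow (by positivity) hpq.pos.ne',
      Real.rpow_inv_rpow (by positivity) hpq.symm.pos.ne'] at this
    refine this.trans_eq ?_
    change C * (Φ Q + ε / 2 + Φ Q + (Γ Q + ε / 2) + Γ Q) = _
    ring
  have hkey0 : ∀ Q, treeSum D.child (paraForm D.child (fun ν => D.avg (b ν))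
      (fun ν => D.avg (f ν)) (fun ν => D.avg (g ν))) k Q ≤ C * (2 * Φ Q + 2 * Γ Q) := by
    intro Q
    refine le_of_forall_pos_le_add fun ε hε => (hkey Q (ε / C) (by positivity)).trans_eq ?_
    field_simp
  calc _ ≤ ∑ v ∈ t, volume.real (D.cube (i, v)) * (C * (2 * Φ (i, v) + 2 * Γ (i, v))) := by
        gcongr with v _
        exact hkey0 _
    _ = 2 * C * ((∑ v ∈ t, volume.real (D.cube (i, v)) * Φ (i, v)) +
        ∑ v ∈ t, volume.real (D.cube (i, v)) * Γ (i, v)) := by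
        rw [← Finset.sum_add_distrib, Finset.mul_sum]
        refine Finset.sum_congr rfl fun v _ => ?_
        ring
    _ ≤ _ := by
        gcongr
        · exact D.sum_volume_mul_avg_le (fun x => Real.rpow_nonneg (l2Norm_nonneg _) _) iP i t
        · exact D.sum_volume_mul_avg_le (fun x => Real.rpow_nonneg (l2Norm_nonneg _) _) iQ i t

end DyadicGrid

/-! ### The square function estimate by duality. -/

namespace DyadicGrid

/-- The square function estimate for finite partial sums of paraproducts. -/
theorem exists_integral_l2Norm_partialPara_le (m : ℕ) (𝕜 : Type*) [RCLike 𝕜] {p : ℝ}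
    (hp : 1 < p) :
    ∃ C : ℝ, 0 < C ∧ ∀ (D : DyadicGrid m) {ι : Type} [Fintype ι]
      {b f : ι → (Fin m → ℝ) → 𝕜}, (∀ ν, LocallyIntegrable (b ν) volume) →
      (∀ ν, D.bmoNorm (b ν) ≤ 1) → (∀ ν, MemLp (f ν) (ENNReal.ofReal p) volume) →
      ∀ s : Finset (CubeIndex m),
      ∫ x, l2Norm (fun ν => D.partialPara (b ν) (f ν) s x) ^ p ≤
        C * ∫ x, l2Norm (fun ν => f ν x) ^ p := by
  have hpq := Real.HolderConjugate.conjExponent hp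
  obtain ⟨q, hq⟩ : ∃ q, q = p.conjExponent := ⟨_, rfl⟩
  rw [← hq] at hpq
  have hq0 := hpq.symm.pos
  have hq1 := hpq.symm.lt
  obtain ⟨C, hC, key⟩ := exists_norm_sum_integral_partialPara_le m 𝕜 hpq
  -- The bound on the form is additive, not a product of norms. With `t ^ (q - 1) = 2 C` the
  -- contribution of the test function is half the left-hand side and can be absorbed.
  set t : ℝ := (2 * C) ^ (q - 1)⁻¹ with ht
  have ht0 : 0 < t := by positivity
  have ht1 : t ^ (q - 1) = 2 * C := Real.rpow_inv_rpow (by positivity) (by linarith)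
  refine ⟨2 * C * t, by positivity, fun D ι _ b f hb hbmo hf s => ?_⟩
  set h : ι → (Fin m → ℝ) → 𝕜 := fun ν => D.partialPara (b ν) (f ν) s with hh
  have hmem : ∀ ν, MemLp (h ν) (ENNReal.ofReal p) volume :=
    fun ν => D.memLp_partialPara _ _ _ _
  let H : (Fin m → ℝ) → ℝ := fun x => l2Norm fun ν => h ν x
  have hH : MemLp H (ENNReal.ofReal p) volume := MemLp.l2Norm hmem
  have hH0 : ∀ x, 0 ≤ H x := fun x => l2Norm_nonneg _
  -- The dual extremiser of `h`, scaled by `t⁻¹`: `∑ h g = t⁻¹ H ^ p` pointwise. Where `H = 0`, the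
  -- value of `H ^ (p - 2)` is immaterial because it multiplies zero.
  let g : ι → (Fin m → ℝ) → 𝕜 := fun ν x =>
    ((t⁻¹ * H x ^ (p - 2) : ℝ) : 𝕜) * (starRingEnd 𝕜) (h ν x)
  have hpow : ∀ x, H x ^ (p - 2) * H x = H x ^ (p - 1) := by
    intro x
    rcases (hH0 x).eq_or_lt with h0 | h0
    · rw [← h0, mul_zero, Real.zero_rpow (by linarith)]
    · rw [← Real.rpow_add_one h0.ne']; ring_nf
  have hpow' : ∀ x, H x ^ (p - 1) * H x = H x ^ p := by
    intro x
    rcases (hH0 x).eq_or_lt with h0 | h0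
    · rw [← h0, mul_zero, Real.zero_rpow (by linarith)]
    · rw [← Real.rpow_add_one h0.ne']; ring_nf
  have hl2g : ∀ x, l2Norm (fun ν => g ν x) = t⁻¹ * H x ^ (p - 1) := by
    intro x
    have h1 : 0 ≤ t⁻¹ * H x ^ (p - 2) :=
      mul_nonneg (by positivity) (Real.rpow_nonneg (hH0 x) _)
    have h2 : l2Norm (fun ν => (starRingEnd 𝕜) (h ν x)) = H x := by simp [H, l2Norm]
    simp only [g]
    rw [l2Norm_smul _ h1, h2, mul_assoc, hpow]
  have hgmem : ∀ ν, MemLp (g ν) (ENNReal.ofReal q) volume := by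
    intro ν
    have h1 : MemLp (fun x => t⁻¹ * H x ^ (p - 1)) (ENNReal.ofReal q) volume := by
      have h2 := (hH.norm_rpow_div (ENNReal.ofReal (p - 1))).const_mul t⁻¹
      rw [ENNReal.toReal_ofReal (by linarith), ← ENNReal.ofReal_div_of_pos (by linarith)] at h2
      rw [hq, Real.conjExponent]
      simpa only [Real.norm_of_nonneg (hH0 _)] using h2
    refine h1.mono' ?_ (Filter.Eventually.of_forall fun x => ?_)
    · have h3 : AEMeasurable (fun x => t⁻¹ * H x ^ (p - 2)) volume :=
        (hH.1.aemeasurable.pow_const _).const_mul _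
      exact (RCLike.measurable_ofReal.comp_aemeasurable h3).aestronglyMeasurable.mul
        (RCLike.continuous_conj.comp_aestronglyMeasurable (hmem ν).1)
    · rw [← hl2g]
      exact norm_le_l2Norm (fun ν => g ν x) ν
  have hint : Integrable (fun x => H x ^ p) volume := by
    have := hH.integrable_norm_rpow (by simp; linarith) ENNReal.ofReal_ne_top
    rw [ENNReal.toReal_ofReal (by linarith)] at this
    simpa only [Real.norm_of_nonneg (hH0 _)] using this
  have hI0 : 0 ≤ ∫ x, H x ^ p := integral_nonneg fun x => Real.rpow_nonneg (hH0 x) _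
  have hsum : ∑ ν, ∫ x, h ν x * g ν x = ((t⁻¹ * ∫ x, H x ^ p : ℝ) : 𝕜) := by
    rw [← integral_finsetSum, ← integral_const_mul, ← integral_ofReal]
    · congr 1
      funext x
      have h1 : ∀ ν, h ν x * g ν x = ((t⁻¹ * H x ^ (p - 2) * ‖h ν x‖ ^ 2 : ℝ) : 𝕜) := by
        intro ν
        simp only [g]
        rw [mul_left_comm, RCLike.mul_conj]
        push_cast
        ring
      simp_rw [h1]
      rw [← RCLike.ofReal_sum, ← Finset.mul_sum, ← sq_l2Norm fun ν => h ν x, ← hpow', ← hpow]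
      congr 1
      simp only [H]
      ring
    · intro ν _
      have := hpq.ennrealOfReal
      exact MemLp.integrable_mul (hmem ν) (hgmem ν)
  have := key D hb hbmo hf hgmem s
  rw [hsum, RCLike.norm_ofReal, abs_of_nonneg (by positivity)] at this
  simp_rw [hl2g] at this
  have h4 : ∀ x, (t⁻¹ * H x ^ (p - 1)) ^ q = (t ^ q)⁻¹ * H x ^ p := fun x => by
    rw [Real.mul_rpow (by positivity) (Real.rpow_nonneg (hH0 x) _), Real.inv_rpow ht0.le,
      rpow_sub_one_rpow_conj hpq (hH0 x)]
  simp_rw [h4] at this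
  rw [integral_const_mul] at this
  have h5 : t ^ q = 2 * C * t := by
    rw [← ht1, ← Real.rpow_add_one ht0.ne', sub_add_cancel]
  rw [h5] at this
  change ∫ x, H x ^ p ≤ _
  set A := ∫ x, H x ^ p
  set B := ∫ x, l2Norm (fun ν => f ν x) ^ p
  have h6 := mul_le_mul_of_nonneg_left this ht0.le
  rw [mul_inv_cancel_left₀ ht0.ne'] at h6
  have h7 : t * (C * (B + (2 * C * t)⁻¹ * A)) = C * t * B + A / 2 := by field_simp
  linarith

end DyadicGrid

/-! ### Khintchine's inequality. -/

theorem sum_signs_succ {N : ℕ} (φ : (Fin (N + 1) → ℤˣ) → ℝ) :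
    ∑ ε, φ ε = ∑ ε : Fin N → ℤˣ, (φ (Fin.cons 1 ε) + φ (Fin.cons (-1) ε)) := by
  rw [← (Fin.consEquiv fun _ => ℤˣ).sum_comp, Fintype.sum_prod_type, Finset.sum_comm]
  refine Finset.sum_congr rfl fun ε _ => ?_
  rw [UnitsInt.univ]
  simp [Fin.consEquiv]

/-- Orthogonality of the signs. The free constant `c` lets the induction absorb one sign at a time
by the parallelogram law. -/
theorem sum_signs_norm_add_sq {𝕜 : Type*} [RCLike 𝕜] {N : ℕ} (c : 𝕜) (a : Fin N → 𝕜) :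
    ∑ ε : Fin N → ℤˣ, ‖c + ∑ n, (ε n : ℤ) • a n‖ ^ 2 = 2 ^ N * (‖c‖ ^ 2 + ∑ n, ‖a n‖ ^ 2) := by
  induction N generalizing c with
  | zero => simp
  | succ N ih =>
    rw [sum_signs_succ, Finset.sum_add_distrib]
    simp only [Fin.sum_univ_succ, Fin.cons_zero, Fin.cons_succ, ← add_assoc]
    rw [ih, ih]
    have := parallelogram_law_with_norm ℝ c (a 0)
    simp only [Units.val_one, one_smul, Units.val_neg, neg_smul, ← sub_eq_add_neg, pow_succ]
    linear_combination 2 ^ N * this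

/-- Subgaussian bound: each sign contributes `cosh a ≤ exp (a² / 2)`. -/
theorem sum_signs_exp_le {N : ℕ} (c : ℝ) (a : Fin N → ℝ) :
    ∑ ε : Fin N → ℤˣ, Real.exp (c + ∑ n, (ε n : ℤ) • a n) ≤
      2 ^ N * Real.exp (c + (∑ n, a n ^ 2) / 2) := by
  induction N generalizing c with
  | zero => simp
  | succ N ih =>
    rw [sum_signs_succ, Finset.sum_add_distrib]
    simp only [Fin.sum_univ_succ, Fin.cons_zero, Fin.cons_succ, ← add_assoc]
    refine (add_le_add (ih _ _) (ih _ _)).trans ?_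
    have := Real.cosh_le_exp_half_sq (a 0)
    rw [Real.cosh_eq] at this
    simp only [Units.val_one, one_smul, Units.val_neg, neg_smul, pow_succ, add_div,
      Real.exp_add] at this ⊢
    have h : 0 ≤ Real.exp c * Real.exp ((∑ i : Fin N, a i.succ ^ 2) / 2) := by positivity
    simp only [pow_succ, pow_zero, one_mul] at *
    have h2 := mul_le_mul_of_nonneg_left this (mul_nonneg (pow_nonneg zero_le_two N) h)
    linarith

theorem rpow_le_mul_exp {r y : ℝ} (hr : 0 < r) (hy : 0 ≤ y) : y ^ r ≤ r ^ r * Real.exp y := by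
  have h : y ≤ r * Real.exp (y / r) := by
    have := Real.add_one_le_exp (y / r)
    calc y = r * (y / r) := by field_simp
      _ ≤ _ := by gcongr; linarith
  calc y ^ r ≤ (r * Real.exp (y / r)) ^ r := by gcongr
    _ = r ^ r * Real.exp y := by
        rw [Real.mul_rpow hr.le (Real.exp_pos _).le, ← Real.exp_mul, div_mul_cancel₀ _ hr.ne']

theorem sum_signs_abs_rpow_le {r : ℝ} (hr : 0 < r) {N : ℕ} {a : Fin N → ℝ}
    (ha : ∑ n, a n ^ 2 ≤ 1) :
    ∑ ε : Fin N → ℤˣ, |∑ n, (ε n : ℤ) • a n| ^ r ≤ 2 ^ N * (2 * r ^ r * Real.exp (1 / 2)) := by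
  have h1 : ∀ y : ℝ, |y| ^ r ≤ r ^ r * (Real.exp y + Real.exp (-y)) := by
    intro y
    refine (rpow_le_mul_exp hr (abs_nonneg y)).trans ?_
    gcongr
    rcases abs_cases y with h | h <;> rw [h.1] <;> linarith [Real.exp_pos y, Real.exp_pos (-y)]
  have h2 : ∀ b : Fin N → ℝ, ∑ n, b n ^ 2 ≤ 1 →
      ∑ ε : Fin N → ℤˣ, Real.exp (∑ n, (ε n : ℤ) • b n) ≤ 2 ^ N * Real.exp (1 / 2) := by
    intro b hb
    have := sum_signs_exp_le 0 b
    simp only [zero_add] at this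
    refine this.trans ?_
    gcongr
  have h3 := h2 (fun n => -a n) (by simpa using ha)
  simp only [smul_neg, Finset.sum_neg_distrib] at h3
  calc _ ≤ ∑ ε : Fin N → ℤˣ, r ^ r * (Real.exp (∑ n, (ε n : ℤ) • a n) +
        Real.exp (-∑ n, (ε n : ℤ) • a n)) := Finset.sum_le_sum fun ε _ => h1 _
    _ = r ^ r * (∑ ε : Fin N → ℤˣ, Real.exp (∑ n, (ε n : ℤ) • a n) +
        ∑ ε : Fin N → ℤˣ, Real.exp (-∑ n, (ε n : ℤ) • a n)) := by
        rw [← Finset.mul_sum, Finset.sum_add_distrib]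
    _ ≤ r ^ r * (2 ^ N * Real.exp (1 / 2) + 2 ^ N * Real.exp (1 / 2)) := by
        gcongr
        exact h2 a ha
    _ = _ := by ring

theorem sum_signs_norm_rpow_le_of_le_one {𝕜 : Type*} [RCLike 𝕜] {r : ℝ} (hr : 0 < r) {N : ℕ}
    {a : Fin N → 𝕜} (ha : ∑ n, ‖a n‖ ^ 2 ≤ 1) :
    ∑ ε : Fin N → ℤˣ, ‖∑ n, (ε n : ℤ) • a n‖ ^ r ≤
      2 ^ N * (2 ^ r * (4 * r ^ r * Real.exp (1 / 2))) := by
  have hre := sum_signs_abs_rpow_le hr (a := fun n => RCLike.re (a n))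
    ((Finset.sum_le_sum fun n _ => sq_le_sq' (abs_le.1 (RCLike.abs_re_le_norm (a n))).1
      (RCLike.re_le_norm (a n))).trans ha)
  have him := sum_signs_abs_rpow_le hr (a := fun n => RCLike.im (a n))
    ((Finset.sum_le_sum fun n _ => sq_le_sq' (abs_le.1 (RCLike.abs_im_le_norm (a n))).1
      (RCLike.im_le_norm (a n))).trans ha)
  have h : ∀ z : 𝕜, ‖z‖ ^ r ≤ 2 ^ r * (|RCLike.re z| ^ r + |RCLike.im z| ^ r) := by
    intro z
    have h1 : ‖z‖ ≤ 2 * max |RCLike.re z| |RCLike.im z| := by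
      have h2 : ‖z‖ ≤ |RCLike.re z| + |RCLike.im z| := by
        calc ‖z‖ = ‖(RCLike.re z : 𝕜) + RCLike.im z * RCLike.I‖ := by rw [RCLike.re_add_im]
          _ ≤ ‖(RCLike.re z : 𝕜)‖ + ‖(RCLike.im z : 𝕜)‖ * ‖(RCLike.I : 𝕜)‖ := by
              rw [← norm_mul]; exact norm_add_le _ _
          _ ≤ |RCLike.re z| + |RCLike.im z| := by
              rw [RCLike.norm_ofReal, RCLike.norm_ofReal]
              gcongr
              exact mul_le_of_le_one_right (abs_nonneg _)
                (by rw [RCLike.norm_I]; split_ifs <;> norm_num)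
      linarith [le_max_left |RCLike.re z| |RCLike.im z|,
        le_max_right |RCLike.re z| |RCLike.im z|]
    calc ‖z‖ ^ r ≤ (2 * max |RCLike.re z| |RCLike.im z|) ^ r := by gcongr
      _ = 2 ^ r * max |RCLike.re z| |RCLike.im z| ^ r :=
          Real.mul_rpow zero_le_two (by positivity)
      _ ≤ _ := by
          gcongr
          rcases max_cases |RCLike.re z| |RCLike.im z| with h | h <;> rw [h.1]
          · exact le_add_of_nonneg_right (by positivity)
          · exact le_add_of_nonneg_left (by positivity)
  refine (Finset.sum_le_sum fun ε _ => h _).trans ?_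
  rw [← Finset.mul_sum, Finset.sum_add_distrib]
  simp only [map_sum, map_zsmul] at hre him ⊢
  have h2 : (0 : ℝ) ≤ 2 ^ r := by positivity
  have := mul_le_mul_of_nonneg_left (add_le_add hre him) h2
  linarith

/-- Khintchine's inequality. -/
theorem exists_khintchine (𝕜 : Type*) [RCLike 𝕜] {p : ℝ} (hp : 0 < p) :
    ∃ A : ℝ, 0 < A ∧ ∀ (N : ℕ) (a : Fin N → 𝕜),
      ∑ ε : Fin N → ℤˣ, ‖∑ n, (ε n : ℤ) • a n‖ ^ p ≤ 2 ^ N * (A * l2Norm a ^ p) ∧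
      2 ^ N * l2Norm a ^ p ≤ A * ∑ ε : Fin N → ℤˣ, ‖∑ n, (ε n : ℤ) • a n‖ ^ p := by
  set B : ℝ → ℝ := fun r => 2 ^ r * (4 * r ^ r * Real.exp (1 / 2)) with hB
  have hB0 : ∀ r, 0 < r → 0 < B r := fun r hr => by positivity
  have hlow : ∃ A : ℝ, 0 < A ∧ ∀ (N : ℕ) (a : Fin N → 𝕜), ∑ n, ‖a n‖ ^ 2 = 1 →
      2 ^ N ≤ A * ∑ ε : Fin N → ℤˣ, ‖∑ n, (ε n : ℤ) • a n‖ ^ p := by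
    -- Averaged over the signs, with second moment `1` and fourth moment at most `B 4`, this
    -- pointwise inequality leaves at least half the second moment to the `X ^ p` term. For `p ≤ 2`
    -- the fourth moment controls large `X`; for `p ≥ 2` the constant `δ` covers small `X`.
    have key : ∃ T : ℝ, 0 < T ∧ ∃ δ : ℝ, 0 ≤ δ ∧ ∃ η : ℝ, 0 ≤ η ∧ δ + η * B 4 ≤ 1 / 2 ∧
        ∀ X : ℝ, 0 ≤ X → X ^ 2 ≤ T ^ (2 - p) * X ^ p + δ + η * X ^ (4 : ℝ) := by
      have hXp : ∀ X : ℝ, 0 < X → X ^ (2 - p) * X ^ p = X ^ 2 := fun X hX => by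
        rw [← Real.rpow_add hX]; norm_num
      rcases le_total p 2 with h2 | h2
      · set T : ℝ := Real.sqrt (2 * B 4) with hT
        have hT0 : 0 < T := Real.sqrt_pos.2 (by have := hB0 4 (by norm_num); positivity)
        have hT2 : T ^ 2 = 2 * B 4 := Real.sq_sqrt (by have := hB0 4 (by norm_num); positivity)
        refine ⟨T, hT0, 0, le_rfl, (T ^ 2)⁻¹, by positivity, ?_, fun X hX => ?_⟩
        · rw [hT2]
          have := hB0 4 (by norm_num)
          apply le_of_eq
          field_simp
          ring
        · rcases hX.eq_or_lt with rfl | hX0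
          · rw [Real.zero_rpow hp.ne', Real.zero_rpow (by norm_num)]; simp
          · have h4 : X ^ (4 : ℝ) = X ^ 4 := by exact_mod_cast Real.rpow_natCast X 4
            rw [h4]
            rcases le_total X T with hXT | hXT
            · have : X ^ (2 - p) ≤ T ^ (2 - p) := Real.rpow_le_rpow hX hXT (by linarith)
              have := mul_le_mul_of_nonneg_right this (Real.rpow_nonneg hX p)
              rw [hXp X hX0] at this
              have : 0 ≤ (T ^ 2)⁻¹ * X ^ 4 := by positivity
              linarith
            · have h5 : X ^ 2 ≤ (T ^ 2)⁻¹ * X ^ 4 := by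
                rw [inv_mul_eq_div, le_div_iff₀ (by positivity)]
                calc X ^ 2 * T ^ 2 ≤ X ^ 2 * X ^ 2 := by gcongr
                  _ = X ^ 4 := by ring
              have : 0 ≤ T ^ (2 - p) * X ^ p := by positivity
              linarith
      · refine ⟨Real.sqrt (1 / 2), by positivity, 1 / 2, by norm_num, 0, le_rfl, by simp,
          fun X hX => ?_⟩
        set T := Real.sqrt (1 / 2) with hT
        have hT0 : 0 < T := by positivity
        have hT2 : T ^ 2 = 1 / 2 := Real.sq_sqrt (by norm_num)
        rcases le_total X T with hXT | hXT
        · have : X ^ 2 ≤ T ^ 2 := by gcongr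
          have : 0 ≤ T ^ (2 - p) * X ^ p := by positivity
          linarith
        · have hX0 : 0 < X := hT0.trans_le hXT
          have : X ^ (2 - p) ≤ T ^ (2 - p) :=
            Real.rpow_le_rpow_of_nonpos hT0 hXT (by linarith)
          have := mul_le_mul_of_nonneg_right this (Real.rpow_nonneg hX p)
          rw [hXp X hX0] at this
          linarith
    obtain ⟨T, hT, δ, hδ, η, hη, hδη, hX⟩ := key
    refine ⟨2 * T ^ (2 - p), by positivity, fun N a ha => ?_⟩
    have h2 := sum_signs_norm_add_sq 0 a
    simp only [zero_add, norm_zero, ha] at h2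
    have h4 := sum_signs_norm_rpow_le_of_le_one (r := 4) (by norm_num) ha.le
    have h5 := Finset.sum_le_sum fun (ε : Fin N → ℤˣ) (_ : ε ∈ Finset.univ) =>
      hX ‖∑ n, (ε n : ℤ) • a n‖ (norm_nonneg _)
    rw [h2, Finset.sum_add_distrib, Finset.sum_add_distrib, ← Finset.mul_sum, ← Finset.mul_sum,
      Finset.sum_const, Finset.card_univ, nsmul_eq_mul] at h5
    have h6 : ((Fintype.card (Fin N → ℤˣ) : ℕ) : ℝ) = 2 ^ N := by simp
    rw [h6] at h5
    have h7 := mul_le_mul_of_nonneg_left h4 hη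
    have h8 := mul_le_mul_of_nonneg_left hδη (show (0 : ℝ) ≤ 2 ^ N by positivity)
    simp only [hB] at h8
    linarith
  obtain ⟨A, hA, hA'⟩ := hlow
  refine ⟨max A (B p), lt_max_of_lt_left hA, fun N a => ?_⟩
  rcases (l2Norm_nonneg a).eq_or_lt with h0 | h0
  · have h1 : ∀ n, a n = 0 := fun n => by
      have := norm_le_l2Norm a n
      rw [← h0] at this
      exact norm_le_zero_iff.1 this
    have h2 : l2Norm a ^ p = 0 := by rw [← h0, Real.zero_rpow hp.ne']
    rw [h2]
    simp [h1, Real.zero_rpow hp.ne']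
  · set σ := l2Norm a with hσ
    set a' : Fin N → 𝕜 := fun n => ((σ⁻¹ : ℝ) : 𝕜) * a n with ha'
    have hone : ∑ n, ‖a' n‖ ^ 2 = 1 := by
      rw [← sq_l2Norm, l2Norm_smul _ (by positivity), ← hσ, inv_mul_cancel₀ h0.ne', one_pow]
    have hscale : ∀ ε : Fin N → ℤˣ, ‖∑ n, (ε n : ℤ) • a n‖ ^ p =
        σ ^ p * ‖∑ n, (ε n : ℤ) • a' n‖ ^ p := by
      intro ε
      rw [← Real.mul_rpow h0.le (norm_nonneg _)]
      congr 1
      simp only [ha', ← mul_smul_comm, ← Finset.mul_sum]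
      rw [norm_mul, RCLike.norm_ofReal, abs_of_pos (by positivity), mul_inv_cancel_left₀ h0.ne']
    simp_rw [hscale, ← Finset.mul_sum]
    have hσp : 0 < σ ^ p := by positivity
    constructor
    · have h1 := sum_signs_norm_rpow_le_of_le_one hp hone.le
      calc σ ^ p * _ ≤ σ ^ p * (2 ^ N * B p) := by gcongr
        _ = 2 ^ N * (B p * σ ^ p) := by ring
        _ ≤ _ := by gcongr; exact le_max_right _ _
    · have h1 := hA' N a' hone
      calc 2 ^ N * σ ^ p ≤ (A * ∑ ε : Fin N → ℤˣ, ‖∑ n, (ε n : ℤ) • a' n‖ ^ p) * σ ^ p := by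
            gcongr
        _ = A * (σ ^ p * ∑ ε : Fin N → ℤˣ, ‖∑ n, (ε n : ℤ) • a' n‖ ^ p) := by ring
        _ ≤ _ := by gcongr; exact le_max_left _ _

/-! ### Minkowski's inequality in two forms. -/

section Minkowski

variable {α ι : Type*} [MeasurableSpace α] {μ : Measure α} [Fintype ι]

/-- Minkowski's inequality in `L^r` for finitely many nonnegative functions. -/
theorem integral_sum_rpow_le {r : ℝ} (hr : 1 ≤ r) {u : ι → α → ℝ} (hu0 : ∀ i x, 0 ≤ u i x)
    (hu : ∀ i, MemLp (u i) (ENNReal.ofReal r) μ) :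
    (∫ x, (∑ i, u i x) ^ r ∂μ) ^ r⁻¹ ≤ ∑ i, (∫ x, u i x ^ r ∂μ) ^ r⁻¹ := by
  have hr0 : 0 < r := by linarith
  have key : ∀ v : α → ℝ, (∀ x, 0 ≤ v x) → MemLp v (ENNReal.ofReal r) μ →
      lpNorm v (ENNReal.ofReal r) μ = (∫ x, v x ^ r ∂μ) ^ r⁻¹ := by
    intro v hv0 hv
    rw [lpNorm_eq_integral_norm_rpow_toReal (by simpa using hr0) ENNReal.ofReal_ne_top hv.1,
      ENNReal.toReal_ofReal hr0.le]
    simp_rw [Real.norm_of_nonneg (hv0 _)]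
  rw [← key _ (fun x => Finset.sum_nonneg fun i _ => hu0 i x) (memLp_finsetSum _ fun i _ => hu i)]
  simp_rw [← key _ (hu0 _) (hu _)]
  have := lpNorm_sum_le (s := Finset.univ) (fun i _ => hu i) (p := ENNReal.ofReal r)
    (by simpa using hr)
  convert this using 2
  ext x
  simp

/-- Minkowski's inequality for integrals of functions with values in a finite dimensional `ℓ^r`
space. -/
theorem sum_integral_rpow_le {r : ℝ} (hr : 1 ≤ r) {v : ι → α → ℝ} (hv0 : ∀ i x, 0 ≤ v i x)
    (hv : ∀ i, Integrable (v i) μ) :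
    (∑ i, (∫ x, v i x ∂μ) ^ r) ^ r⁻¹ ≤ ∫ x, (∑ i, v i x ^ r) ^ r⁻¹ ∂μ := by
  have hr0 : 0 < r := by linarith
  have : Fact (1 ≤ ENNReal.ofReal r) := ⟨by simpa using hr⟩
  have hr' : (ENNReal.ofReal r).toReal = r := ENNReal.toReal_ofReal hr0.le
  have key : ∀ a : ι → ℝ, (∀ i, 0 ≤ a i) →
      ‖(WithLp.toLp (ENNReal.ofReal r) a : PiLp (ENNReal.ofReal r) fun _ : ι => ℝ)‖ =
        (∑ i, a i ^ r) ^ r⁻¹ := by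
    intro a ha
    rw [PiLp.norm_eq_sum (by rw [hr']; exact hr0), hr', one_div]
    simp only [Real.norm_of_nonneg (ha _)]
  have h := norm_integral_le_integral_norm (μ := μ) fun x =>
    (WithLp.toLp (ENNReal.ofReal r) (fun i => v i x) : PiLp (ENNReal.ofReal r) fun _ : ι => ℝ)
  have h2 : (∫ x, (WithLp.toLp (ENNReal.ofReal r) (fun i => v i x) :
      PiLp (ENNReal.ofReal r) fun _ : ι => ℝ) ∂μ) =
      WithLp.toLp (ENNReal.ofReal r) fun i => ∫ x, v i x ∂μ := by
    ext i
    rw [eval_integral_piLp]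
    exact hv
  rw [h2, key _ fun i => integral_nonneg (hv0 i)] at h
  simp_rw [key _ (fun i => hv0 i _)] at h
  exact h

end Minkowski

/-! ### Equivalence of random norms and square functions in `L^p`. -/

section Rademacher

variable {α : Type*} [MeasurableSpace α] {μ : Measure α} {𝕜 : Type*} [RCLike 𝕜]

theorem rademacherNorm_nonneg {X : Type*} [NormedAddCommGroup X] {N : ℕ} (x : Fin N → X) :
    0 ≤ rademacherNorm x := Real.sqrt_nonneg _

theorem sq_rademacherNorm {X : Type*} [NormedAddCommGroup X] {N : ℕ} (x : Fin N → X) :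
    rademacherNorm x ^ 2 = (∑ ε : Fin N → ℤˣ, ‖∑ n, (ε n : ℤ) • x n‖ ^ 2) / 2 ^ N :=
  Real.sq_sqrt (by positivity)

theorem Lp_norm_rpow_eq_integral {E : Type*} [NormedAddCommGroup E] {p : ℝ≥0∞} (hp0 : p ≠ 0)
    (hp : p ≠ ∞) (f : Lp E p μ) : ‖f‖ ^ p.toReal = ∫ x, ‖f x‖ ^ p.toReal ∂μ := by
  rw [Lp.norm_def, toReal_eLpNorm (Lp.aestronglyMeasurable f),
    lpNorm_eq_integral_norm_rpow_toReal hp0 hp (Lp.aestronglyMeasurable f),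
    Real.rpow_inv_rpow (integral_nonneg fun x => by positivity)
      (ENNReal.toReal_pos hp0 hp).ne']

/-- The random norm of a finite family in `L^p` is equivalent to the norm of its square
function. -/
theorem exists_integral_l2Norm_equiv_rademacherNorm (𝕜 : Type*) [RCLike 𝕜] {p : ℝ≥0∞}
    [hp1 : Fact (1 ≤ p)] (hp : p ≠ ∞) :
    ∃ A : ℝ, 0 < A ∧ ∀ {α : Type} [MeasurableSpace α] {μ : Measure α} (N : ℕ)
      (f : Fin N → Lp 𝕜 p μ),
      ∫ x, l2Norm (fun n => f n x) ^ p.toReal ∂μ ≤ A * rademacherNorm f ^ p.toReal ∧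
      rademacherNorm f ^ p.toReal ≤ A * ∫ x, l2Norm (fun n => f n x) ^ p.toReal ∂μ := by
  have hp0 : p ≠ 0 := (zero_lt_one.trans_le hp1.out).ne'
  have hP : 0 < p.toReal := ENNReal.toReal_pos hp0 hp
  obtain ⟨A, hA, hK⟩ := exists_khintchine 𝕜 hP
  refine ⟨A + 1, by positivity, fun {α} _ {μ} N f => ?_⟩
  set P := p.toReal with hPdef
  let F : (Fin N → ℤˣ) → α → 𝕜 := fun ε x => ∑ n, (ε n : ℤ) • f n x
  let ν : (Fin N → ℤˣ) → ℝ := fun ε => ‖∑ n, (ε n : ℤ) • f n‖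
  let l : α → ℝ := fun x => l2Norm fun n => f n x
  have hl0 : ∀ x, 0 ≤ l x := fun x => l2Norm_nonneg _
  have hν0 : ∀ ε, 0 ≤ ν ε := fun ε => norm_nonneg _
  have hcoe : ∀ ε, (∑ n, (ε n : ℤ) • f n : Lp 𝕜 p μ) =ᵐ[μ] F ε := by
    intro ε
    have h1 : ∀ n, ((ε n : ℤ) • f n : Lp 𝕜 p μ) =ᵐ[μ] fun x => (ε n : ℤ) • f n x := by
      intro n
      rcases Int.units_eq_one_or (ε n) with h | h
      · simp [h]
      · simp only [h, Units.val_neg, Units.val_one, neg_smul, one_smul]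
        exact Lp.coeFn_neg (f n)
    filter_upwards [Lp.coeFn_finsetSum Finset.univ fun n => (ε n : ℤ) • f n,
      Filter.eventually_all.2 h1] with x hx hx1
    rw [hx, Finset.sum_apply]
    exact Finset.sum_congr rfl fun n _ => hx1 n
  have hFmem : ∀ ε, MemLp (F ε) p μ := fun ε => (Lp.memLp _).ae_eq (hcoe ε)
  have hνP : ∀ ε, ν ε ^ P = ∫ x, ‖F ε x‖ ^ P ∂μ := by
    intro ε
    simp only [ν]
    rw [Lp_norm_rpow_eq_integral hp0 hp]
    refine integral_congr_ae ?_
    filter_upwards [hcoe ε] with x hx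
    rw [hx]
  have hFint : ∀ ε, Integrable (fun x => ‖F ε x‖ ^ P) μ := fun ε =>
    (hFmem ε).integrable_norm_rpow hp0 hp
  have hlint : Integrable (fun x => l x ^ P) μ := by
    have := (MemLp.l2Norm fun n => Lp.memLp (f n)).integrable_norm_rpow hp0 hp
    simpa only [Real.norm_of_nonneg (l2Norm_nonneg _)] using this
  have h2N : (0 : ℝ) < 2 ^ N := by positivity
  set I := ∫ x, l x ^ P ∂μ with hI
  have hI0 : 0 ≤ I := integral_nonneg fun x => Real.rpow_nonneg (hl0 x) _
  have hup : ∑ ε, ν ε ^ P ≤ 2 ^ N * (A * I) := by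
    simp_rw [hνP]
    rw [← integral_finsetSum _ fun ε _ => hFint ε, hI, ← integral_const_mul, ← integral_const_mul]
    exact integral_mono (integrable_finsetSum _ fun ε _ => hFint ε)
      ((hlint.const_mul _).const_mul _) fun x => (hK N fun n => f n x).1
  have hlow : 2 ^ N * I ≤ A * ∑ ε, ν ε ^ P := by
    simp_rw [hνP]
    rw [← integral_finsetSum _ fun ε _ => hFint ε, hI, ← integral_const_mul, ← integral_const_mul]
    exact integral_mono (hlint.const_mul _)
      ((integrable_finsetSum _ fun ε _ => hFint ε).const_mul _) fun x => (hK N fun n => f n x).2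
  have hsq : ∀ x, ∑ ε, ‖F ε x‖ ^ (2 : ℝ) = 2 ^ N * l x ^ (2 : ℝ) := by
    intro x
    have := sum_signs_norm_add_sq 0 fun n => f n x
    simp only [zero_add, norm_zero, ne_eq, OfNat.ofNat_ne_zero, not_false_eq_true, zero_pow,
      ← sq_l2Norm fun n => f n x] at this
    simpa only [Real.rpow_two] using this
  set R := rademacherNorm f with hR
  have hR0 : 0 ≤ R := rademacherNorm_nonneg f
  have hR2 : ∑ ε, ν ε ^ (2 : ℝ) = 2 ^ N * R ^ (2 : ℝ) := by
    simp only [Real.rpow_two]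
    rw [hR, sq_rademacherNorm, mul_div_cancel₀ _ h2N.ne']
  -- Monotonicity of power means over the signs, which links the `P`-th moment of Khintchine's
  -- inequality to the second moment in `rademacherNorm`.
  have hmean : ∀ {s t : ℝ}, 0 < s → s ≤ t →
      ((∑ ε, ν ε ^ s) / 2 ^ N) ^ (t / s) ≤ (∑ ε, ν ε ^ t) / 2 ^ N := by
    intro s t hs hst
    have := Real.rpow_arith_mean_le_arith_mean_rpow Finset.univ
      (fun _ : Fin N → ℤˣ => ((2 : ℝ) ^ N)⁻¹) (fun ε => ν ε ^ s) (fun _ _ => by positivity)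
      (by simp) (fun ε _ => Real.rpow_nonneg (hν0 ε) _) ((one_le_div hs).2 hst)
    simp_rw [← Real.rpow_mul (hν0 _), mul_div_cancel₀ t hs.ne', ← Finset.mul_sum] at this
    rwa [div_eq_inv_mul (∑ ε, ν ε ^ s), div_eq_inv_mul (∑ ε, ν ε ^ t)]
  have hRP : ∀ s t : ℝ, s ≠ 0 → (R ^ s) ^ (t / s) = R ^ t := fun s t hs => by
    rw [← Real.rpow_mul hR0, mul_div_cancel₀ t hs]
  have hRPnn : 0 ≤ R ^ P := Real.rpow_nonneg hR0 _
  have hweak : ∀ {x y : ℝ}, 0 ≤ y → x ≤ A * y → x ≤ (A + 1) * y := fun hy h => by linarith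
  have hweak' : ∀ {x y : ℝ}, 0 ≤ y → x ≤ y → x ≤ (A + 1) * y := fun hy h => by nlinarith
  -- On either side of `2`, one inequality follows from Khintchine and power means. The other
  -- follows from Minkowski and the exact second moment `hsq`, with constant `1`.
  rcases le_total P 2 with hP2 | hP2
  · constructor
    · refine hweak hRPnn ?_
      have h1 := hmean hP hP2
      rw [hR2, mul_div_cancel_left₀ _ h2N.ne'] at h1
      have h2 : (∑ ε, ν ε ^ P) / 2 ^ N ≤ R ^ P := by
        have h3 : 0 ≤ (∑ ε, ν ε ^ P) / 2 ^ N :=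
          div_nonneg (Finset.sum_nonneg fun ε _ => Real.rpow_nonneg (hν0 ε) _) h2N.le
        have h4 := Real.rpow_le_rpow (Real.rpow_nonneg h3 _) h1 (show 0 ≤ P / 2 by positivity)
        rwa [hRP _ _ two_ne_zero, ← Real.rpow_mul h3, show 2 / P * (P / 2) = 1 by field_simp,
          Real.rpow_one] at h4
      rw [div_le_iff₀ h2N] at h2
      have := mul_le_mul_of_nonneg_left h2 hA.le
      refine le_of_mul_le_mul_left ?_ h2N
      linarith
    · refine hweak' hI0 ?_
      have h1 := sum_integral_rpow_le (μ := μ) (r := 2 / P) ((one_le_div hP).2 hP2)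
        (v := fun ε x => ‖F ε x‖ ^ P) (fun ε x => by positivity) hFint
      simp_rw [← hνP, ← Real.rpow_mul (hν0 _), ← Real.rpow_mul (norm_nonneg _),
        mul_div_cancel₀ (2 : ℝ) hP.ne', hsq, hR2, inv_div] at h1
      simp_rw [Real.mul_rpow h2N.le (Real.rpow_nonneg (hl0 _) _),
        Real.mul_rpow h2N.le (Real.rpow_nonneg hR0 _), hRP 2 P two_ne_zero,
        ← Real.rpow_mul (hl0 _), mul_div_cancel₀ P (two_ne_zero' ℝ)] at h1
      rw [integral_const_mul] at h1
      exact le_of_mul_le_mul_left h1 (by positivity)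
  · constructor
    · refine hweak' hRPnn ?_
      have hP2' : 1 ≤ P / 2 := by linarith
      have hmem : ∀ ε, MemLp (fun x => ‖F ε x‖ ^ (2 : ℝ)) (ENNReal.ofReal (P / 2)) μ := by
        intro ε
        have := (hFmem ε).norm_rpow_div (ENNReal.ofReal 2)
        rw [ENNReal.toReal_ofReal zero_le_two] at this
        rwa [ENNReal.ofReal_div_of_pos zero_lt_two, hPdef, ENNReal.ofReal_toReal hp]
      have h1 := integral_sum_rpow_le (μ := μ) hP2' (u := fun ε x => ‖F ε x‖ ^ (2 : ℝ))
        (fun ε x => by positivity) hmem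
      simp_rw [hsq, Real.mul_rpow h2N.le (Real.rpow_nonneg (hl0 _) _), ← Real.rpow_mul (hl0 _),
        ← Real.rpow_mul (norm_nonneg _), mul_div_cancel₀ P (two_ne_zero' ℝ), ← hνP, inv_div,
        ← Real.rpow_mul (hν0 _), mul_div_cancel₀ (2 : ℝ) hP.ne', hR2, integral_const_mul] at h1
      rw [Real.mul_rpow (by positivity) hI0, ← Real.rpow_mul h2N.le,
        show P / 2 * (2 / P) = 1 by field_simp, Real.rpow_one] at h1
      have h2 := le_of_mul_le_mul_left h1 h2N
      have h3 := Real.rpow_le_rpow (Real.rpow_nonneg hI0 _) h2 (show 0 ≤ P / 2 by positivity)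
      rwa [hRP _ _ two_ne_zero, ← Real.rpow_mul hI0, show 2 / P * (P / 2) = 1 by field_simp,
        Real.rpow_one] at h3
    · refine hweak hI0 ?_
      have h1 := hmean two_pos hP2
      rw [hR2, mul_div_cancel_left₀ _ h2N.ne', hRP _ _ two_ne_zero] at h1
      refine h1.trans ?_
      rw [div_le_iff₀ h2N]
      linarith

end Rademacher

/-! ### Unconditional convergence from bounded partial sums. -/

section Summable

/-- The blocks with sign `+1` and those with sign `-1` each form a single partial sum. -/
theorem norm_sum_signs_smul_le {X : Type*} [NormedAddCommGroup X] {κ : Type*} {x : κ → X} {C : ℝ}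
    (hC : ∀ s : Finset κ, ‖∑ i ∈ s, x i‖ ≤ C) {K : ℕ} {s : Fin K → Finset κ}
    (hs : Pairwise (Function.onFun Disjoint s)) (ε : Fin K → ℤˣ) :
    ‖∑ k, (ε k : ℤ) • ∑ i ∈ s k, x i‖ ≤ 2 * C := by
  classical
  have h1 : ∀ t : Finset (Fin K), ‖∑ k ∈ t, ∑ i ∈ s k, x i‖ ≤ C := by
    intro t
    rw [← Finset.sum_biUnion fun k _ l _ hkl => hs hkl]
    exact hC _
  have h2 : ∑ k, (ε k : ℤ) • ∑ i ∈ s k, x i =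
      ∑ k ∈ Finset.univ.filter (fun k => ε k = 1), ∑ i ∈ s k, x i -
        ∑ k ∈ Finset.univ.filter (fun k => ¬ ε k = 1), ∑ i ∈ s k, x i := by
    rw [← Finset.sum_filter_add_sum_filter_not Finset.univ (fun k => ε k = 1), sub_eq_add_neg,
      ← Finset.sum_neg_distrib]
    congr 1
    · exact Finset.sum_congr rfl fun k hk => by simp [(Finset.mem_filter.1 hk).2]
    · refine Finset.sum_congr rfl fun k hk => ?_
      rcases Int.units_eq_one_or (ε k) with h | h
      · exact absurd h (Finset.mem_filter.1 hk).2
      · simp [h]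
  rw [h2, two_mul]
  exact (norm_sub_le _ _).trans (add_le_add (h1 _) (h1 _))

/-- Where the Cauchy criterion fails, a block of norm at least `δ` exists off any finite set, so
blocks can be chosen one after another. -/
theorem exists_pairwise_disjoint_of_not_summable {X : Type*} [NormedAddCommGroup X]
    [CompleteSpace X] {κ : Type*} {x : κ → X} (hx : ¬ Summable x) :
    ∃ δ > 0, ∀ K : ℕ, ∃ s : Fin K → Finset κ, Pairwise (Function.onFun Disjoint s) ∧
      ∀ k, δ ≤ ‖∑ i ∈ s k, x i‖ := by
  classical
  rw [summable_iff_vanishing_norm] at hx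
  push Not at hx
  obtain ⟨δ, hδ, h⟩ := hx
  refine ⟨δ, hδ, fun K => ?_⟩
  induction K with
  | zero => exact ⟨Fin.elim0, fun i => i.elim0, fun i => i.elim0⟩
  | succ K ih =>
    obtain ⟨s, hs, hsδ⟩ := ih
    obtain ⟨t, ht, htδ⟩ := h (Finset.univ.biUnion s)
    have hd : ∀ k, Disjoint t (s k) := fun k =>
      ht.mono_right (Finset.subset_biUnion_of_mem s (Finset.mem_univ k))
    refine ⟨Fin.cons t s, ?_, Fin.cases htδ hsδ⟩
    intro i j
    refine Fin.cases ?_ (fun i => ?_) i <;> refine Fin.cases ?_ (fun j => ?_) j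
    · exact fun h => absurd rfl h
    · exact fun _ => hd j
    · exact fun _ => (hd i).symm
    · exact fun h => @hs i j fun hij => h (congrArg Fin.succ hij)

/-- Superadditivity of the power for `r ≥ 1`, power means for `r ≤ 1`. Applied to squares with `r =
P / 2`, it compares the `ℓ²` norm with the `ℓ^P` norm. -/
theorem card_rpow_mul_sum_rpow_le {r : ℝ} (hr : 0 < r) {K : ℕ} (hK : 0 < K) {a : Fin K → ℝ}
    (ha : ∀ k, 0 ≤ a k) :
    (K : ℝ) ^ (min 1 r - 1) * ∑ k, a k ^ r ≤ (∑ k, a k) ^ r := by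
  have hK0 : (0 : ℝ) < K := by exact_mod_cast hK
  have hS : 0 ≤ ∑ k, a k := Finset.sum_nonneg fun k _ => ha k
  rcases le_total 1 r with h | h
  · rw [min_eq_left h, sub_self, Real.rpow_zero, one_mul]
    have h1 : ∀ x : ℝ, 0 ≤ x → x ^ r = x * x ^ (r - 1) := by
      intro x hx
      rcases hx.eq_or_lt with rfl | hx
      · simp [hr.ne']
      · rw [← Real.rpow_one_add' hx.le (by linarith)]; ring_nf
    rw [h1 _ hS, Finset.sum_mul]
    refine Finset.sum_le_sum fun k _ => ?_
    rw [h1 _ (ha k)]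
    refine mul_le_mul_of_nonneg_left (Real.rpow_le_rpow (ha k) ?_ (by linarith)) (ha k)
    exact Finset.single_le_sum (fun k _ => ha k) (Finset.mem_univ k)
  · rw [min_eq_right h]
    have h1 := Real.rpow_arith_mean_le_arith_mean_rpow Finset.univ (fun _ : Fin K => (K : ℝ)⁻¹)
      (fun k => a k ^ r) (fun _ _ => by positivity) (by simp [hK0.ne'])
      (fun k _ => Real.rpow_nonneg (ha k) _) ((one_le_inv₀ hr).2 h)
    simp_rw [Real.rpow_rpow_inv (ha _) hr.ne', ← Finset.mul_sum] at h1
    have h2 := Real.rpow_le_rpow (Real.rpow_nonneg (mul_nonneg (inv_nonneg.2 hK0.le)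
      (Finset.sum_nonneg fun k _ => Real.rpow_nonneg (ha k) _)) _) h1 hr.le
    rw [Real.rpow_inv_rpow (mul_nonneg (inv_nonneg.2 hK0.le)
      (Finset.sum_nonneg fun k _ => Real.rpow_nonneg (ha k) _)) hr.ne',
      Real.mul_rpow (by positivity) hS, Real.inv_rpow hK0.le, inv_mul_eq_div, inv_mul_eq_div,
      div_le_div_iff₀ hK0 (by positivity)] at h2
    rw [Real.rpow_sub_one hK0.ne', div_mul_eq_mul_div, div_le_iff₀ hK0]
    linarith

/-- A series in `L^p`, `p < ∞`, whose finite partial sums are bounded converges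
unconditionally. -/
theorem summable_Lp_of_norm_sum_le {𝕜 : Type*} [RCLike 𝕜] {p : ℝ≥0∞} [hp1 : Fact (1 ≤ p)]
    (hp : p ≠ ∞) {α : Type} [MeasurableSpace α] {μ : Measure α} {κ : Type*} {x : κ → Lp 𝕜 p μ}
    {C : ℝ} (hC : ∀ s : Finset κ, ‖∑ i ∈ s, x i‖ ≤ C) : Summable x := by
  by_contra hx
  obtain ⟨δ, hδ, h⟩ := exists_pairwise_disjoint_of_not_summable hx
  have hp0 : p ≠ 0 := (zero_lt_one.trans_le hp1.out).ne'
  have hP : 0 < p.toReal := ENNReal.toReal_pos hp0 hp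
  obtain ⟨A, hA, hequiv⟩ := exists_integral_l2Norm_equiv_rademacherNorm 𝕜 hp
  set P := p.toReal with hPdef
  have hC0 : 0 ≤ C := by simpa using hC ∅
  -- A cotype estimate: `K` disjoint blocks of norm at least `δ` have a random norm growing like a
  -- positive power of `K`, yet it is at most `2 C`.
  have key : ∀ K : ℕ, 0 < K → (K : ℝ) ^ min 1 (P / 2) * δ ^ P ≤ A * (2 * C) ^ P := by
    intro K hK
    have hK0 : (0 : ℝ) < K := by exact_mod_cast hK
    obtain ⟨s, hs, hsδ⟩ := h K
    set y : Fin K → Lp 𝕜 p μ := fun k => ∑ i ∈ s k, x i with hy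
    have hR : rademacherNorm y ≤ 2 * C := by
      refine Real.sqrt_le_iff.2 ⟨by positivity, ?_⟩
      rw [div_le_iff₀ (by positivity)]
      calc ∑ ε : Fin K → ℤˣ, ‖∑ k, (ε k : ℤ) • y k‖ ^ 2
          ≤ ∑ ε : Fin K → ℤˣ, (2 * C) ^ 2 := by
            gcongr with ε _
            exact norm_sum_signs_smul_le hC hs ε
        _ = (2 * C) ^ 2 * 2 ^ K := by simp [mul_comm]
    have hint : ∀ k, Integrable (fun x => ‖y k x‖ ^ P) μ := fun k =>
      (Lp.memLp (y k)).integrable_norm_rpow hp0 hp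
    have hlint : Integrable (fun x => l2Norm (fun k => y k x) ^ P) μ := by
      have := (MemLp.l2Norm fun k => Lp.memLp (y k)).integrable_norm_rpow hp0 hp
      simpa only [Real.norm_of_nonneg (l2Norm_nonneg _)] using this
    have hpt : ∀ z, (K : ℝ) ^ (min 1 (P / 2) - 1) * ∑ k, ‖y k z‖ ^ P ≤
        l2Norm (fun k => y k z) ^ P := by
      intro z
      have h1 := card_rpow_mul_sum_rpow_le (r := P / 2) (by positivity) hK
        (a := fun k => ‖y k z‖ ^ 2) fun k => by positivity
      rw [← sq_l2Norm fun k => y k z] at h1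
      simp_rw [← Real.rpow_two, ← Real.rpow_mul (norm_nonneg _), ← Real.rpow_mul (l2Norm_nonneg _),
        mul_div_cancel₀ P (two_ne_zero' ℝ)] at h1
      exact h1
    have h2 := integral_mono ((integrable_finsetSum _ fun k _ => hint k).const_mul _) hlint hpt
    rw [integral_const_mul, integral_finsetSum _ fun k _ => hint k] at h2
    simp_rw [hPdef, ← Lp_norm_rpow_eq_integral hp0 hp] at h2
    have h3 : (K : ℝ) * δ ^ P ≤ ∑ k, ‖y k‖ ^ P := by
      calc (K : ℝ) * δ ^ P = ∑ _k : Fin K, δ ^ P := by simp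
        _ ≤ _ := by
          gcongr with k _
          exact hsδ k
    calc (K : ℝ) ^ min 1 (P / 2) * δ ^ P
        = (K : ℝ) ^ (min 1 (P / 2) - 1) * (K * δ ^ P) := by
          rw [Real.rpow_sub_one hK0.ne']; field_simp
      _ ≤ (K : ℝ) ^ (min 1 (P / 2) - 1) * ∑ k, ‖y k‖ ^ P := by gcongr
      _ ≤ _ := h2
      _ ≤ A * rademacherNorm y ^ P := (hequiv K y).1
      _ ≤ _ := by gcongr; exact rademacherNorm_nonneg y
  have htend := ((tendsto_rpow_atTop (show 0 < min 1 (P / 2) by positivity)).comp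
    tendsto_natCast_atTop_atTop).atTop_mul_const (show 0 < δ ^ P by positivity)
  obtain ⟨K, hK, hK'⟩ := ((htend.eventually_gt_atTop (A * (2 * C) ^ P)).and
    (Filter.eventually_gt_atTop 0)).exists
  exact absurd (key K hK') (not_le.2 hK)

end Summable

/-! ### The paraproduct operators and their R-bound. -/

theorem rademacherNorm_fin_one {X : Type*} [NormedAddCommGroup X] (x : Fin 1 → X) :
    rademacherNorm x = ‖x 0‖ := by
  have h : ∀ ε : Fin 1 → ℤˣ, ‖∑ n, (ε n : ℤ) • x n‖ = ‖x 0‖ := by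
    intro ε
    rcases Int.units_eq_one_or (ε 0) with h | h <;> simp [h]
  rw [rademacherNorm]
  simp_rw [h]
  simp

theorem continuous_rademacherNorm {X : Type*} [NormedAddCommGroup X] {N : ℕ} :
    Continuous (rademacherNorm : (Fin N → X) → ℝ) := by
  unfold rademacherNorm
  fun_prop

namespace DyadicGrid

variable {m : ℕ} {𝕜 : Type*} [RCLike 𝕜] (D : DyadicGrid m) {p : ℝ≥0∞}

theorem avg_congr_ae {f g : (Fin m → ℝ) → 𝕜} (h : f =ᵐ[volume] g) (Q : CubeIndex m) :
    D.avg f Q = D.avg g Q := by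
  rw [avg, avg, setAverage_eq, setAverage_eq, integral_congr_ae (ae_restrict_of_ae h)]

theorem avg_coe_add [hp1 : Fact (1 ≤ p)] (f g : Lp 𝕜 p (volume : Measure (Fin m → ℝ))) (Q : CubeIndex m) :
    D.avg (fun x => (f + g) x) Q = D.avg (fun x => f x) Q + D.avg (fun x => g x) Q := by
  rw [D.avg_congr_ae (Lp.coeFn_add f g), avg, avg, avg, setAverage_eq, setAverage_eq,
    setAverage_eq, ← smul_add]
  congr 1
  exact integral_add (((Lp.memLp f).locallyIntegrable hp1.out).integrableOn_cube D Q)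
    (((Lp.memLp g).locallyIntegrable hp1.out).integrableOn_cube D Q)

theorem avg_coe_smul (c : 𝕜) (f : Lp 𝕜 p (volume : Measure (Fin m → ℝ))) (Q : CubeIndex m) :
    D.avg (fun x => (c • f) x) Q = c * D.avg (fun x => f x) Q := by
  rw [D.avg_congr_ae (Lp.coeFn_smul c f), avg, avg, setAverage_eq, setAverage_eq, mul_smul_comm]
  congr 1
  exact integral_const_mul c _

/-- The term of the paraproduct series with index `Q`, as an element of `L^p`. -/
def paraTerm (b : (Fin m → ℝ) → 𝕜) (f : Lp 𝕜 p (volume : Measure (Fin m → ℝ)))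
    (Q : CubeIndex m) : Lp 𝕜 p (volume : Measure (Fin m → ℝ)) :=
  D.avg (fun x => f x) Q • (D.memLp_martingaleDiff b Q p).toLp (D.martingaleDiff b Q)

theorem coeFn_sum_paraTerm (b : (Fin m → ℝ) → 𝕜) (f : Lp 𝕜 p (volume : Measure (Fin m → ℝ)))
    (s : Finset (CubeIndex m)) :
    (∑ Q ∈ s, D.paraTerm b f Q : Lp 𝕜 p (volume : Measure (Fin m → ℝ))) =ᵐ[volume]
      D.partialPara b (fun x => f x) s := by
  have h1 : ∀ᵐ x ∂(volume : Measure (Fin m → ℝ)), ∀ Q : CubeIndex m,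
      D.paraTerm b f Q x = D.avg (fun x => f x) Q * D.martingaleDiff b Q x := by
    rw [ae_all_iff]
    intro Q
    filter_upwards [Lp.coeFn_smul (D.avg (fun x => f x) Q)
      ((D.memLp_martingaleDiff b Q p).toLp (D.martingaleDiff b Q)),
      (D.memLp_martingaleDiff b Q p).coeFn_toLp] with x hx hx'
    rw [paraTerm, hx, Pi.smul_apply, hx', smul_eq_mul]
  filter_upwards [Lp.coeFn_finsetSum s (D.paraTerm b f), h1] with x hx hx1
  rw [hx, Finset.sum_apply, partialPara]
  exact Finset.sum_congr rfl fun Q _ => hx1 Q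

/-- The square function estimate framed by the two halves of the norm equivalence. Uniformity in `s`
serves both convergence and the passage to the limit. -/
theorem exists_rademacherNorm_sum_paraTerm_le (m : ℕ) (𝕜 : Type*) [RCLike 𝕜] {p : ℝ≥0∞}
    [Fact (1 ≤ p)] (hp_one : 1 < p) (hp_top : p ≠ ∞) :
    ∃ C : ℝ, 0 ≤ C ∧ ∀ (D : DyadicGrid m) (N : ℕ) (b : Fin N → (Fin m → ℝ) → 𝕜),
      (∀ n, LocallyIntegrable (b n) volume) → (∀ n, D.bmoNorm (b n) ≤ 1) →
      ∀ (f : Fin N → Lp 𝕜 p (volume : Measure (Fin m → ℝ))) (s : Finset (CubeIndex m)),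
      rademacherNorm (fun n => ∑ Q ∈ s, D.paraTerm (b n) (f n) Q) ≤ C * rademacherNorm f := by
  have hP1 : 1 < p.toReal := by
    simpa using (ENNReal.toReal_lt_toReal ENNReal.one_ne_top hp_top).2 hp_one
  have hP : 0 < p.toReal := by linarith
  have hpP : ENNReal.ofReal p.toReal = p := ENNReal.ofReal_toReal hp_top
  obtain ⟨C, hC, hint⟩ := exists_integral_l2Norm_partialPara_le m 𝕜 hP1
  obtain ⟨A, hA, hequiv⟩ := exists_integral_l2Norm_equiv_rademacherNorm 𝕜 hp_top
  rw [hpP] at hint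
  refine ⟨(A * C * A) ^ p.toReal⁻¹, by positivity, fun D N b hb hbmo f s => ?_⟩
  set g : Fin N → Lp 𝕜 p (volume : Measure (Fin m → ℝ)) :=
    fun n => ∑ Q ∈ s, D.paraTerm (b n) (f n) Q with hg
  have hcongr : ∫ x, l2Norm (fun n => g n x) ^ p.toReal =
      ∫ x, l2Norm (fun n => D.partialPara (b n) (fun x => f n x) s x) ^ p.toReal := by
    refine integral_congr_ae ?_
    filter_upwards [Filter.eventually_all.2 fun n => D.coeFn_sum_paraTerm (b n) (f n) s] with x hx
    simp only [hg, hx]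
  have h1 : rademacherNorm g ^ p.toReal ≤ A * C * A * rademacherNorm f ^ p.toReal := by
    calc rademacherNorm g ^ p.toReal ≤ A * ∫ x, l2Norm (fun n => g n x) ^ p.toReal :=
          (hequiv N g).2
      _ ≤ A * (C * ∫ x, l2Norm (fun n => f n x) ^ p.toReal) := by
          rw [hcongr]
          gcongr
          exact hint D hb hbmo (fun n => Lp.memLp (f n)) s
      _ ≤ A * (C * (A * rademacherNorm f ^ p.toReal)) := by
          gcongr
          exact (hequiv N f).1
      _ = _ := by ring
  have h2 := Real.rpow_le_rpow (Real.rpow_nonneg (rademacherNorm_nonneg g) _) h1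
    (inv_nonneg.2 hP.le)
  rwa [Real.rpow_rpow_inv (rademacherNorm_nonneg g) hP.ne', Real.mul_rpow (by positivity)
    (Real.rpow_nonneg (rademacherNorm_nonneg f) _),
    Real.rpow_rpow_inv (rademacherNorm_nonneg f) hP.ne'] at h2

end DyadicGrid

end

theorem proposition5p1 {𝕜 : Type*} [RCLike 𝕜] (m : ℕ) (p : ℝ≥0∞) [Fact (1 ≤ p)]
    (hp_one : 1 < p) (hp_top : p < ∞) :
    ∃ C : ℝ≥0, ∀ (D : DyadicGrid m) (ι : Type*) (b : ι → (Fin m → ℝ) → 𝕜),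
      (∀ i, LocallyIntegrable (b i) volume) →
      (∀ i, D.bmoNorm (b i) ≤ 1) →
      ∃ T : ι → Lp 𝕜 p (volume : Measure (Fin m → ℝ)) →L[𝕜]
          Lp 𝕜 p (volume : Measure (Fin m → ℝ)),
        (∀ i, D.IsParaproduct (b i) (T i)) ∧ HasRBound (Set.range T) C := by
  obtain ⟨C, hC, hbound⟩ :=
    DyadicGrid.exists_rademacherNorm_sum_paraTerm_le m 𝕜 hp_one hp_top.ne
  refine ⟨⟨C, hC⟩, fun D ι b hb hbmo => ?_⟩
  have hpartial : ∀ i f (s : Finset (CubeIndex m)),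
      ‖∑ Q ∈ s, D.paraTerm (p := p) (b i) f Q‖ ≤ C * ‖f‖ := by
    intro i f s
    -- For a single function the random norm is the norm itself, so the R-bound contains the uniform
    -- bound on partial sums.
    have := hbound D 1 (fun _ => b i) (fun _ => hb i) (fun _ => hbmo i) (fun _ => f) s
    rwa [rademacherNorm_fin_one, rademacherNorm_fin_one] at this
  have hsum : ∀ i f, Summable (D.paraTerm (p := p) (b i) f) := fun i f =>
    summable_Lp_of_norm_sum_le hp_top.ne (hpartial i f)
  let T : ι → Lp 𝕜 p (volume : Measure (Fin m → ℝ)) →L[𝕜]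
      Lp 𝕜 p (volume : Measure (Fin m → ℝ)) := fun i =>
    LinearMap.mkContinuous
      { toFun := fun f => ∑' Q, D.paraTerm (b i) f Q
        map_add' := fun f g => by
          rw [← (hsum i f).tsum_add (hsum i g)]
          refine tsum_congr fun Q => ?_
          rw [DyadicGrid.paraTerm, D.avg_coe_add, add_smul]
          rfl
        map_smul' := fun c f => by
          rw [RingHom.id_apply, ← (hsum i f).tsum_const_smul c]
          refine tsum_congr fun Q => ?_
          rw [DyadicGrid.paraTerm, D.avg_coe_smul, mul_smul]
          rfl } C fun f =>
      le_of_tendsto (hsum i f).hasSum.norm (Filter.Eventually.of_forall (hpartial i f))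
  have hT : ∀ i f, HasSum (D.paraTerm (b i) f) (T i f) := fun i f => (hsum i f).hasSum
  refine ⟨T, hT, fun N S f hS => ?_⟩
  choose i hi using hS
  -- One finite set `s` serves all `N` series at once, so the net of truncated families converges
  -- and keeps its bound.
  have hlim : Filter.Tendsto
      (fun s => rademacherNorm fun n => ∑ Q ∈ s, D.paraTerm (b (i n)) (f n) Q)
      Filter.atTop (nhds (rademacherNorm fun n => S n (f n))) := by
    refine (continuous_rademacherNorm.tendsto _).comp (tendsto_pi_nhds.2 fun n => ?_)
    rw [← hi n]
    exact hT (i n) (f n)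
  exact le_of_tendsto hlim (Filter.Eventually.of_forall fun s =>
    hbound D N (fun n => b (i n)) (fun n => hb _) (fun n => hbmo _) f s)
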